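/- Let $X=(X_t)_{t\ge 0}$ be, under $P_x$, the continuous-time simple random walk on $\mathbb{Z}$ with jump rate $1$ started at $x\in\mathbb{Z}$, with expectation $E_x$, and let $H_y=\inf\{t\ge 0: X_t=y\}$. For $\eta\le 0$, a bounded function $\zeta:\mathbb{Z}\to(-\infty,0]$ and $x\le y$, define on the stopped $\sigma$-algebra $\sigma((X_{t\wedge H_y})_{t\ge 0})$ $$P_{x,y}^{\zeta,\eta}(A)=\frac{1}{Z_{x,y}^{\zeta,\eta}}\,E_x\Big[\exp\Big(\int_0^{H_y}(\zeta(X_s)+\eta)\,ds\Big);A\Big],\qquad Z_{x,y}^{\zeta,\eta}=E_x\Big[\exp\Big(\int_0^{H_y}(\zeta(X_s)+\eta)\,ds\Big)\Big],$$ and let $P_x^{\zeta,\eta}$ denote a probability measure on $\sigma((X_t)_{t\ge 0})$ which agrees with $P_{x,z}^{\zeta,\eta}$ on $\sigma((X_{t\wedge H_z})_{t\ge 0})$ for every integer $z\ge x$. For a constant $\gamma\le 0$, write $P_x^{\gamma,\eta}$ for $P_x^{\zeta,\eta}$ with $\zeta\equiv\gamma$. Let $\Delta\ge 0$, $\zeta:\mathbb{Z}\to[-\Delta,0]$,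 $\eta\le 0$, and let $x\le y$ be integers and $t\ge 0$. Then (with $X$ constructed on the product space of its jump increments and holding times) the measures $P_x^{0,\eta}$, $P_x^{\zeta,\eta}$ and $P_x^{-\Delta,\eta}$ exist, and $$P_x^{0,\eta}(H_y\le t)\le P_x^{\zeta,\eta}(H_y\le t)\le P_x^{-\Delta,\eta}(H_y\le t).$$ -/

import Mathlib

open MeasureTheory ProbabilityTheory
open scoped NNReal ENNReal

namespace TiltedWalk

noncomputable section

/-- The law of one increment of simple random walk: `+1` or `-1` with probability `1/2` each. -/
def stepLaw : Measure ℤ :=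
  (2⁻¹ : ℝ≥0∞) • Measure.dirac (1 : ℤ) + (2⁻¹ : ℝ≥0∞) • Measure.dirac (-1 : ℤ)

instance : IsProbabilityMeasure stepLaw :=
  ⟨by simp [stepLaw, ENNReal.inv_two_add_inv_two]⟩

/-- The law of one holding time: `Exp(1)`, as a law on `[0, ∞)`. -/
def holdLaw : Measure ℝ≥0 := (expMeasure 1).map Real.toNNReal

instance : IsProbabilityMeasure holdLaw :=
  haveI := isProbabilityMeasure_expMeasure one_pos
  Measure.isProbabilityMeasure_map measurable_real_toNNReal.aemeasurable

/-- The sample space: `(ω n).1` is the `(n+1)`-st increment of the jump chain and `(ω n).2` is the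
`(n+1)`-st holding time. -/
abbrev Sample : Type := ℕ → ℤ × ℝ≥0

/-- Increments and holding times are all independent; increments have law `stepLaw` and holding
times have law `Exp(1)`. -/
def baseLaw : Measure Sample := Measure.infinitePi fun _ : ℕ => stepLaw.prod holdLaw

/-- The jump chain started at `x`. -/
def jumpChain (x : ℤ) (n : ℕ) (ω : Sample) : ℤ := x + ∑ i ∈ Finset.range n, (ω i).1

/-- The number of jumps up to time `t`: the largest `m` such that the sum of the first `m` holding
times is at most `t`. (On the null event that there is no largest such `m` the value is `0`.) -/
def jumpCount (t : ℝ≥0) (ω : Sample) : ℕ :=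
  sSup {m : ℕ | ∑ i ∈ Finset.range m, (ω i).2 ≤ t}

/-- Under `baseLaw`, `walk x` is the continuous-time simple random walk on `ℤ` with jump rate `1`
started at `x`; its law is the law of `X` under `P_x`. -/
def walk (x : ℤ) (t : ℝ≥0) (ω : Sample) : ℤ := jumpChain x (jumpCount t ω) ω

/-- The hitting time `H_y = inf {t ≥ 0 : X_t = y}` of the walk started at `x`
(`⊤` if `y` is never hit). -/
def hit (x y : ℤ) : Sample → WithTop ℝ≥0 := hittingAfter (walk x) {y} 0

/-- The `σ`-algebra `σ((X_t)_{t ≥ 0})` generated by the walk started at `x`. -/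
@[reducible] def walkSigma (x : ℤ) : MeasurableSpace Sample :=
  ⨆ t : ℝ≥0, MeasurableSpace.comap (walk x t) ⊤

/-- The `σ`-algebra `σ((X_{t ∧ H_y})_{t ≥ 0})` generated by the walk started at `x` and stopped
at `H_y`. -/
@[reducible] def stoppedSigma (x y : ℤ) : MeasurableSpace Sample :=
  ⨆ t : ℝ≥0, MeasurableSpace.comap (stoppedProcess (walk x) (hit x y) t) ⊤

/-- The weight `exp (∫_0^{H_y} (ζ(X_s) + η) ds)` for the walk started at `x`.
(The simple random walk is recurrent, so `H_y < ∞` almost surely under `baseLaw`.) -/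
def weight (x y : ℤ) (ζ : ℤ → ℝ) (η : ℝ) (ω : Sample) : ℝ≥0∞ :=
  ENNReal.ofReal (Real.exp
    (∫ s in {s : ℝ | 0 ≤ s ∧ (s.toNNReal : WithTop ℝ≥0) < hit x y ω},
      (ζ (walk x s.toNNReal ω) + η)))

/-- The normalizing constant `Z_{x,y}^{ζ,η} = E_x[exp (∫_0^{H_y} (ζ(X_s) + η) ds)]`. -/
def normConst (x y : ℤ) (ζ : ℤ → ℝ) (η : ℝ) : ℝ≥0∞ := ∫⁻ ω, weight x y ζ η ω ∂baseLaw

/-- `P_{x,y}^{ζ,η}(A) = (1 / Z_{x,y}^{ζ,η}) E_x[exp (∫_0^{H_y} (ζ(X_s) + η) ds); A]`, to be used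
for `x ≤ y` and for events `A` of `σ((X_{t ∧ H_y})_{t ≥ 0})`. -/
def stoppedTiltedProb (x y : ℤ) (ζ : ℤ → ℝ) (η : ℝ) (A : Set Sample) : ℝ≥0∞ :=
  (normConst x y ζ η)⁻¹ * ∫⁻ ω in A, weight x y ζ η ω ∂baseLaw

/-- `Q` is the tilted measure `P_x^{ζ,η}`: the probability measure on `σ((X_t)_{t ≥ 0})` that
extends `P_{x,z}^{ζ,η}` on `σ((X_{t ∧ H_z})_{t ≥ 0})` for every `z ≥ x`. -/
structure IsTiltedLaw (x : ℤ) (ζ : ℤ → ℝ) (η : ℝ) (Q : @Measure Sample (walkSigma x)) :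
    Prop where
  isProbabilityMeasure : @IsProbabilityMeasure Sample (walkSigma x) Q
  eq_stopped : ∀ z : ℤ, x ≤ z → ∀ A : Set Sample, MeasurableSet[stoppedSigma x z] A →
    Q A = stoppedTiltedProb x z ζ η A

end

end TiltedWalk

/-! Put `c = -(ζ + η) ≥ 0`. Integrating out the holding times, `Z_{x,y}` becomes `passSum c x y`, a
sum over nearest-neighbour paths from `x` to `y` in which every step from `z` costs a factor `(1 + c
z)⁻¹`. Such a path visits every intermediate site, so `Z_{x,y} = Z_{x,z} Z_{z,y}` for `x ≤ z ≤ y`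
(`passSum_mul_passSum`).

The tilt is therefore a Doob transform with `h(z) = Z_{z,y}`. Its ratios `h(z+1)/h(z) = 1/Z_{z,z+1}`
and `h(z-1)/h(z) = Z_{z-1,z}` do not involve `y`, so a single Markov walk serves all targets: it
jumps up from `z` at rate `1/(2 Z_{z,z+1})` and down at rate `Z_{z-1,z}/2`, with total rate `1 + c
z` (`passSum_harmonic`). That its path density telescopes to the required weight is
`lintegral_hitSet_tiltedLaw`; existence follows in `isTiltedLaw_trim`.

For the comparison let `c ≤ c'`. Then `Z' ≤ Z` (`passSum_anti`), so the `c'`-walk has larger up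
rates and smaller down rates. Let `v(x,t)` be the probability that the `c'`-walk started at `x` hits
`y` by time `t`. Since `v` increases in `x` up to `y` (`hitProb_mono_start`), it is a supersolution
of the renewal equation of the `c`-walk; the different total rates are reconciled by a resolvent
identity (`lconvolution_expDensity_le`). The hitting probability of the `c`-walk is the limit of the
iterates of its equation started from zero, hence lies below `v` (`hitProb_le_hitProb`). No coupling
is needed. Apply this to `-η ≤ -(ζ + η) ≤ D - η`. -/

namespace TiltedWalk

noncomputable section

/-! ### First-step decomposition of i.i.d. sequences -/

/-- Prepend an entry to a sequence. -/
def seqCons {α : Type*} (a : α) (ω : ℕ → α) : ℕ → α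
  | 0 => a
  | n + 1 => ω n

@[simp] theorem seqCons_zero {α : Type*} (a : α) (ω : ℕ → α) : seqCons a ω 0 = a := rfl

@[simp] theorem seqCons_succ {α : Type*} (a : α) (ω : ℕ → α) (n : ℕ) :
    seqCons a ω (n + 1) = ω n := rfl

theorem measurable_seqCons {α : Type*} [MeasurableSpace α] :
    Measurable fun p : α × (ℕ → α) => seqCons p.1 p.2 := by
  refine measurable_pi_lambda _ fun n => ?_
  cases n with
  | zero => exact measurable_fst
  | succ n => exact (measurable_pi_apply n).comp measurable_snd

/-- This is the source of every first-step analysis below: the preimage of a cylinder splits into a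
condition on the new entry and a cylinder with indices shifted by one. -/
theorem map_seqCons_infinitePi {α : Type*} [MeasurableSpace α] (μ : Measure α)
    [IsProbabilityMeasure μ] :
    (μ.prod (Measure.infinitePi fun _ : ℕ => μ)).map (fun p => seqCons p.1 p.2) =
      Measure.infinitePi fun _ : ℕ => μ := by
  classical
  refine Measure.eq_infinitePi _ fun s t ht => ?_
  have hs : MeasurableSet (Set.pi (s : Set ℕ) t) :=
    MeasurableSet.pi s.countable_toSet fun i _ => ht i
  rw [Measure.map_apply measurable_seqCons hs]
  have hset : (fun p : α × (ℕ → α) => seqCons p.1 p.2) ⁻¹' (Set.pi (s : Set ℕ) t) =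
      (if 0 ∈ s then t 0 else Set.univ) ×ˢ
        Set.pi ((s.preimage (· + 1) (add_left_injective 1).injOn : Finset ℕ) : Set ℕ)
          fun n => t (n + 1) := by
    ext ⟨a, ω⟩
    simp only [Set.mem_preimage, Set.mem_pi, Finset.mem_coe, Set.mem_prod, Finset.mem_preimage]
    constructor
    · intro h
      refine ⟨?_, fun n hn => h (n + 1) hn⟩
      split_ifs with h0
      · exact h 0 h0
      · trivial
    · rintro ⟨h0, h1⟩ (_ | n) hn
      · simpa [hn] using h0
      · exact h1 n hn
  rw [hset, Measure.prod_prod, Measure.infinitePi_pi _ fun i _ => ht (i + 1)]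
  have hprod : ∏ i ∈ s.preimage (· + 1) (add_left_injective 1).injOn, μ (t (i + 1)) =
      ∏ i ∈ s.erase 0, μ (t i) := by
    have : s.erase 0 = (s.preimage (· + 1) (add_left_injective 1).injOn).image (· + 1) := by
      ext n
      cases n <;> simp
    rw [this, Finset.prod_image (add_left_injective 1).injOn]
  rw [hprod]
  split_ifs with h0
  · exact Finset.mul_prod_erase s (fun i => μ (t i)) h0
  · rw [measure_univ, one_mul, Finset.erase_eq_of_notMem h0]

theorem lintegral_infinitePi_seqCons {α : Type*} [MeasurableSpace α] (μ : Measure α)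
    [IsProbabilityMeasure μ] {f : (ℕ → α) → ℝ≥0∞} (hf : Measurable f) :
    ∫⁻ ω, f ω ∂(Measure.infinitePi fun _ : ℕ => μ) =
      ∫⁻ a, ∫⁻ ω, f (seqCons a ω) ∂(Measure.infinitePi fun _ : ℕ => μ) ∂μ := by
  conv_lhs => rw [← map_seqCons_infinitePi μ]
  rw [lintegral_map hf measurable_seqCons]
  exact lintegral_prod _ (hf.comp measurable_seqCons).aemeasurable

/-! ### Exponential kernels and the law of one step -/

/-- The exponential function of rate `r` on `[0, ∞)`, extended by zero. -/
def expDensity (r s : ℝ) : ℝ≥0∞ := ENNReal.ofReal (if 0 ≤ s then Real.exp (-(r * s)) else 0)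

theorem measurable_expDensity (r : ℝ) : Measurable (expDensity r) := by
  unfold expDensity
  refine ENNReal.measurable_ofReal.comp (Measurable.ite measurableSet_Ici ?_ measurable_const)
  fun_prop

theorem expDensity_of_neg {r s : ℝ} (hs : s < 0) : expDensity r s = 0 := by
  simp [expDensity, not_le.2 hs]

theorem expDensity_of_nonneg {r s : ℝ} (hs : 0 ≤ s) :
    expDensity r s = ENNReal.ofReal (Real.exp (-(r * s))) := by
  simp [expDensity, hs]

theorem expDensity_mul_exp (r c s : ℝ) :
    expDensity r s * ENNReal.ofReal (Real.exp (-(c * s))) = expDensity (r + c) s := by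
  rcases lt_or_ge s 0 with hs | hs
  · simp [expDensity_of_neg hs]
  · rw [expDensity_of_nonneg hs, expDensity_of_nonneg hs, ← ENNReal.ofReal_mul (Real.exp_nonneg _),
      ← Real.exp_add]
    congr 2
    ring

theorem lintegral_expDensity {r : ℝ} (hr : 0 < r) :
    ∫⁻ s, expDensity r s = (ENNReal.ofReal r)⁻¹ := by
  have h := lintegral_exponentialPDF_eq_one hr
  have h2 : ∀ s, exponentialPDF r s = ENNReal.ofReal r * expDensity r s := by
    intro s
    rw [exponentialPDF_eq, expDensity, ← ENNReal.ofReal_mul hr.le]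
    congr 1
    split_ifs <;> simp
  simp_rw [h2] at h
  rw [lintegral_const_mul _ (measurable_expDensity r)] at h
  rw [mul_comm] at h
  exact ENNReal.eq_inv_of_mul_eq_one_left h

theorem expMeasure_one_eq : expMeasure 1 = volume.withDensity (expDensity 1) := by
  rw [expMeasure, gammaMeasure]
  congr 1
  ext s
  have := exponentialPDF_eq 1 s
  rw [exponentialPDF, exponentialPDFReal] at this
  rw [gammaPDF, this, expDensity]
  simp

theorem lintegral_holdLaw {f : ℝ → ℝ≥0∞} (hf : Measurable f) :
    ∫⁻ τ, f τ ∂holdLaw = ∫⁻ s, expDensity 1 s * f s := by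
  rw [holdLaw, lintegral_map (f := fun τ : ℝ≥0 => f τ) (hf.comp measurable_coe_nnreal_real)
      measurable_real_toNNReal, expMeasure_one_eq,
    lintegral_withDensity_eq_lintegral_mul₀ (g := fun s : ℝ => f s.toNNReal)
      (measurable_expDensity 1).aemeasurable
      (hf.comp (measurable_coe_nnreal_real.comp measurable_real_toNNReal)).aemeasurable]
  refine lintegral_congr fun s => ?_
  simp only [Pi.mul_apply]
  rcases lt_or_ge s 0 with hs | hs
  · simp [expDensity_of_neg hs]
  · rw [Real.coe_toNNReal s hs]

theorem holdLaw_singleton_zero : holdLaw {0} = 0 := by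
  have h1 : Measurable fun s : ℝ => Set.indicator {(0 : ℝ)} (1 : ℝ → ℝ≥0∞) s :=
    measurable_one.indicator (measurableSet_singleton 0)
  have h := lintegral_holdLaw h1
  have h2 : ∫⁻ τ : ℝ≥0, Set.indicator {(0 : ℝ)} (1 : ℝ → ℝ≥0∞) τ ∂holdLaw = holdLaw {0} := by
    rw [← lintegral_indicator_one (measurableSet_singleton (0 : ℝ≥0))]
    refine lintegral_congr fun τ => ?_
    simp [Set.indicator_apply]
  rw [← h2, h]
  refine (lintegral_eq_zero_iff ((measurable_expDensity 1).mul h1)).2 ?_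
  have : ∀ᵐ s : ℝ, s ≠ 0 := by simp [ae_iff]
  filter_upwards [this] with s hs
  simp [hs]

theorem lintegral_stepLaw_prod_holdLaw {f : ℤ × ℝ≥0 → ℝ≥0∞} (hf : Measurable f) :
    ∫⁻ a, f a ∂(stepLaw.prod holdLaw) =
      2⁻¹ * ∫⁻ τ, f (1, τ) ∂holdLaw + 2⁻¹ * ∫⁻ τ, f (-1, τ) ∂holdLaw := by
  rw [lintegral_prod _ hf.aemeasurable, stepLaw, lintegral_add_measure, lintegral_smul_measure,
    lintegral_smul_measure, lintegral_dirac, lintegral_dirac]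
  rfl

/-! ### Normalizing constants as discounted hitting sums -/

/-- The discounted probability that simple random walk started at `x` first hits `y` at step `n`,
where a step from `z` is discounted by `(1 + c z)⁻¹`. -/
def passTerm (c : ℤ → ℝ≥0) (y : ℤ) : ℕ → ℤ → ℝ≥0∞
  | 0, x => if x = y then 1 else 0
  | n + 1, x => if x = y then 0 else
      (1 + (c x : ℝ≥0∞))⁻¹ * (2⁻¹ * passTerm c y n (x + 1) + 2⁻¹ * passTerm c y n (x - 1))

/-- The discounted probability that simple random walk started at `x` hits `y`. -/
def passSum (c : ℤ → ℝ≥0) (x y : ℤ) : ℝ≥0∞ := ∑' n, passTerm c y n x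

theorem passTerm_zero (c : ℤ → ℝ≥0) (x y : ℤ) :
    passTerm c y 0 x = if x = y then 1 else 0 := rfl

theorem passTerm_succ (c : ℤ → ℝ≥0) (y : ℤ) (n : ℕ) (x : ℤ) :
    passTerm c y (n + 1) x = if x = y then 0 else
      (1 + (c x : ℝ≥0∞))⁻¹ * (2⁻¹ * passTerm c y n (x + 1) + 2⁻¹ * passTerm c y n (x - 1)) := rfl

theorem passSum_self (c : ℤ → ℝ≥0) (y : ℤ) : passSum c y y = 1 := by
  rw [passSum, tsum_eq_zero_add' ENNReal.summable]
  simp [passTerm_zero, passTerm_succ]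

theorem passSum_of_ne (c : ℤ → ℝ≥0) {x y : ℤ} (h : x ≠ y) :
    passSum c x y =
      (1 + (c x : ℝ≥0∞))⁻¹ * (2⁻¹ * passSum c (x + 1) y + 2⁻¹ * passSum c (x - 1) y) := by
  rw [passSum, tsum_eq_zero_add' ENNReal.summable]
  simp only [passTerm_zero, passTerm_succ, if_neg h, zero_add, ENNReal.tsum_mul_left,
    ENNReal.tsum_add, passSum]

theorem sum_passTerm_succ (c : ℤ → ℝ≥0) (y : ℤ) (n : ℕ) (x : ℤ) :
    ∑ i ∈ Finset.range (n + 1), passTerm c y i x = if x = y then 1 else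
      (1 + (c x : ℝ≥0∞))⁻¹ * (2⁻¹ * ∑ i ∈ Finset.range n, passTerm c y i (x + 1) +
        2⁻¹ * ∑ i ∈ Finset.range n, passTerm c y i (x - 1)) := by
  rw [Finset.sum_range_succ']
  by_cases h : x = y
  · simp [passTerm_zero, passTerm_succ, h]
  · simp only [passTerm_zero, passTerm_succ, if_neg h, add_zero]
    rw [← Finset.mul_sum, Finset.sum_add_distrib, ← Finset.mul_sum, ← Finset.mul_sum]

theorem passSum_le_of_sum_le {c : ℤ → ℝ≥0} {x y : ℤ} {K : ℝ≥0∞}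
    (h : ∀ n, ∑ i ∈ Finset.range n, passTerm c y i x ≤ K) : passSum c x y ≤ K := by
  rw [passSum, ENNReal.tsum_eq_iSup_nat]
  exact iSup_le h

theorem sum_passTerm_le (c : ℤ → ℝ≥0) (x y : ℤ) (n : ℕ) :
    ∑ i ∈ Finset.range n, passTerm c y i x ≤ passSum c x y :=
  ENNReal.sum_le_tsum _

/-- Minimality of the hitting sums among supersolutions. -/
theorem passSum_mul_le (c : ℤ → ℝ≥0) {z : ℤ} {F : ℤ → ℝ≥0∞} {K : ℝ≥0∞} (hz : K ≤ F z)
    (hF : ∀ x < z, (1 + (c x : ℝ≥0∞))⁻¹ * (2⁻¹ * F (x + 1) + 2⁻¹ * F (x - 1)) ≤ F x)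
    {x : ℤ} (hx : x ≤ z) : passSum c x z * K ≤ F x := by
  have key : ∀ n : ℕ, ∀ x ≤ z, (∑ i ∈ Finset.range n, passTerm c z i x) * K ≤ F x := by
    intro n
    induction n with
    | zero => intro x _; simp
    | succ n ih =>
      intro x hx
      rw [sum_passTerm_succ]
      split_ifs with h
      · rw [one_mul, h]; exact hz
      · have hlt : x < z := lt_of_le_of_ne hx h
        refine le_trans ?_ (hF x hlt)
        rw [mul_assoc, add_mul, mul_assoc, mul_assoc]
        gcongr
        · exact ih _ (by omega)
        · exact ih _ (by omega)
  rw [passSum, ENNReal.tsum_eq_iSup_nat, ENNReal.iSup_mul]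
  exact iSup_le fun n => key n x hx

/-- A path from `x` to `y` must pass through `z`. In the induction on its length, a step from a site
below `z` cannot jump over `z`. -/
theorem passSum_le_mul (c : ℤ → ℝ≥0) {x z y : ℤ} (hxz : x ≤ z) (hzy : z ≤ y) :
    passSum c x y ≤ passSum c x z * passSum c z y := by
  refine passSum_le_of_sum_le fun n => ?_
  induction n generalizing x with
  | zero => simp
  | succ n ih =>
    rcases eq_or_lt_of_le hxz with rfl | h
    · rw [passSum_self, one_mul]
      exact sum_passTerm_le _ _ _ _
    · rw [sum_passTerm_succ, if_neg (by omega), passSum_of_ne c h.ne, mul_assoc, add_mul,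
        mul_assoc, mul_assoc]
      gcongr
      · exact ih (by omega)
      · exact ih (by omega)

theorem passSum_mul_passSum (c : ℤ → ℝ≥0) {x z y : ℤ} (hxz : x ≤ z) (hzy : z ≤ y) :
    passSum c x z * passSum c z y = passSum c x y := by
  refine le_antisymm ?_ (passSum_le_mul c hxz hzy)
  -- As a function of its starting point, the hitting sum for `y` solves the one-step equation left
  -- of `z`, so minimality applies with boundary value `passSum c z y`.
  refine passSum_mul_le c (F := fun w => passSum c w y) le_rfl (fun w hw => ?_) hxz
  exact (passSum_of_ne c (by omega)).ge

/-- Stronger discounting turns a solution for `c` into a supersolution for `c'`. -/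
theorem passSum_anti {c c' : ℤ → ℝ≥0} (h : ∀ z, c z ≤ c' z) {x y : ℤ} (hxy : x ≤ y) :
    passSum c' x y ≤ passSum c x y := by
  rw [← mul_one (passSum c' x y)]
  refine passSum_mul_le c' (F := fun w => passSum c w y) (passSum_self c y).ge (fun w hw => ?_) hxy
  rw [passSum_of_ne c hw.ne]
  have := h w
  gcongr

theorem passSum_le_one (c : ℤ → ℝ≥0) {x y : ℤ} (hxy : x ≤ y) : passSum c x y ≤ 1 := by
  rw [← mul_one (passSum c x y)]
  refine passSum_mul_le c (F := fun _ => 1) le_rfl (fun w _ => ?_) hxy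
  rw [mul_one, ENNReal.inv_two_add_inv_two, mul_one]
  simp

theorem passSum_ne_top (c : ℤ → ℝ≥0) {x y : ℤ} (hxy : x ≤ y) : passSum c x y ≠ ⊤ :=
  ((passSum_le_one c hxy).trans_lt ENNReal.one_lt_top).ne

theorem passSum_ne_zero (c : ℤ → ℝ≥0) {x y : ℤ} (hxy : x ≤ y) : passSum c x y ≠ 0 := by
  induction x, hxy using Int.leInductionDown with
  | base => simp [passSum_self]
  | pred x hx ih =>
    rw [passSum_of_ne c (by omega), sub_add_cancel]
    have : (1 + (c (x - 1) : ℝ≥0∞)) ≠ ⊤ := by simp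
    simp [ih, this]

/-- This is the one-step equation at `z` for the target `z + 1`, with `passSum c (z - 1) (z + 1)`
factored at `z`, divided by `passSum c z (z + 1)`. It says that the jump rates of the tilted walk
add up to `1 + c z`. -/
theorem passSum_harmonic (c : ℤ → ℝ≥0) (z : ℤ) :
    2⁻¹ * (passSum c z (z + 1))⁻¹ + 2⁻¹ * passSum c (z - 1) z = 1 + (c z : ℝ≥0∞) := by
  have h := passSum_of_ne c (show z ≠ z + 1 by omega)
  rw [passSum_self,
    ← passSum_mul_passSum c (show z - 1 ≤ z by omega) (show z ≤ z + 1 by omega)] at h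
  set g := passSum c z (z + 1)
  have hg0 : g ≠ 0 := passSum_ne_zero c (by omega)
  have hgt : g ≠ ⊤ := passSum_ne_top c (by omega)
  have hc0 : (1 + (c z : ℝ≥0∞)) ≠ 0 := by simp
  have hct : (1 + (c z : ℝ≥0∞)) ≠ ⊤ := by simp
  have h2 : (1 + (c z : ℝ≥0∞)) * g = 2⁻¹ * 1 + 2⁻¹ * (passSum c (z - 1) z * g) := by
    conv_lhs => rw [h]
    rw [← mul_assoc, ENNReal.mul_inv_cancel hc0 hct, one_mul]
  calc _ = (2⁻¹ * 1 + 2⁻¹ * (passSum c (z - 1) z * g)) * g⁻¹ := by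
        rw [add_mul, mul_one, mul_assoc, mul_assoc, ENNReal.mul_inv_cancel hg0 hgt, mul_one]
    _ = _ := by rw [← h2, mul_assoc, ENNReal.mul_inv_cancel hg0 hgt, mul_one]

/-- Recurrence of simple random walk. -/
theorem passSum_zero {x y : ℤ} (hxy : x ≤ y) : passSum 0 x y = 1 := by
  have hshift : ∀ n : ℕ, ∀ x y : ℤ, passTerm 0 (y - 1) n (x - 1) = passTerm 0 y n x := by
    intro n
    induction n with
    | zero => intro x y; simp [passTerm_zero]
    | succ n ih =>
      intro x y
      rw [passTerm_succ, passTerm_succ, ← ih (x + 1) y, ← ih (x - 1) y]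
      simp
  have hstep : ∀ z : ℤ, passSum 0 z (z + 1) = 1 := by
    intro z
    have h := passSum_harmonic 0 z
    -- Without discount the one-step constant `g` is translation invariant, so the harmonic relation
    -- reads `g⁻¹ + g = 2`, which forces `g = 1`.
    have hs : passSum 0 (z - 1) z = passSum 0 z (z + 1) := by
      unfold passSum
      refine tsum_congr fun n => ?_
      rw [← hshift n z (z + 1), add_sub_cancel_right]
    rw [hs] at h
    have hg0 : passSum 0 z (z + 1) ≠ 0 := passSum_ne_zero 0 (by omega)
    have hgt : passSum 0 z (z + 1) ≠ ⊤ := passSum_ne_top 0 (by omega)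
    lift passSum 0 z (z + 1) to ℝ≥0 using hgt with g
    have hg0' : g ≠ 0 := by exact_mod_cast hg0
    have h' : (2 : ℝ≥0)⁻¹ * g⁻¹ + 2⁻¹ * g = 1 := by
      have : (((2 : ℝ≥0)⁻¹ * g⁻¹ + 2⁻¹ * g : ℝ≥0) : ℝ≥0∞) = ((1 : ℝ≥0) : ℝ≥0∞) := by
        push_cast [ENNReal.coe_inv hg0', ENNReal.coe_inv (two_ne_zero)]
        simpa using h
      exact_mod_cast this
    have h3 : (2 : ℝ)⁻¹ * (g : ℝ)⁻¹ + 2⁻¹ * g = 1 := by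
      simpa using congrArg NNReal.toReal h'
    have hgr : (g : ℝ) ≠ 0 := by exact_mod_cast hg0'
    have h4 : ((g : ℝ) - 1) ^ 2 = 0 := by
      field_simp at h3
      linarith
    have h5 : (g : ℝ) = 1 := by
      have := pow_eq_zero_iff (two_ne_zero) |>.1 h4
      linarith
    exact_mod_cast h5
  induction x, hxy using Int.leInductionDown with
  | base => exact passSum_self 0 y
  | pred x hx ih =>
    rw [← passSum_mul_passSum 0 (show x - 1 ≤ x by omega) hx, ih, mul_one]
    simpa using hstep (x - 1)

/-! ### First-hit events, collected cost and truncation -/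

theorem jumpChain_zero (x : ℤ) (ω : Sample) : jumpChain x 0 ω = x := by simp [jumpChain]

theorem jumpChain_seqCons (x : ℤ) (n : ℕ) (a : ℤ × ℝ≥0) (ω : Sample) :
    jumpChain x (n + 1) (seqCons a ω) = jumpChain (x + a.1) n ω := by
  simp only [jumpChain, Finset.sum_range_succ', seqCons_succ, seqCons_zero]
  ring

theorem measurable_jumpChain (x : ℤ) (n : ℕ) : Measurable (jumpChain x n) := by
  unfold jumpChain
  fun_prop

/-- The event that the jump chain started at `x` first visits `y` at step `n`. -/
def hitSet (x y : ℤ) (n : ℕ) : Set Sample :=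
  {ω | jumpChain x n ω = y ∧ ∀ m < n, jumpChain x m ω ≠ y}

theorem measurableSet_hitSet (x y : ℤ) (n : ℕ) : MeasurableSet (hitSet x y n) := by
  have h : hitSet x y n =
      {ω | jumpChain x n ω = y} ∩ ⋂ m, ⋂ (_ : m < n), {ω | jumpChain x m ω = y}ᶜ := by
    ext ω
    simp [hitSet]
  have hm : ∀ m, MeasurableSet {ω | jumpChain x m ω = y} := fun m =>
    measurable_jumpChain x m (measurableSet_singleton y)
  rw [h]
  exact (hm n).inter (MeasurableSet.iInter fun m => MeasurableSet.iInter fun _ => (hm m).compl)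

theorem pairwise_disjoint_hitSet (x y : ℤ) : Pairwise (Function.onFun Disjoint (hitSet x y)) := by
  intro m n hmn
  refine Set.disjoint_left.2 fun ω hm hn => ?_
  rcases lt_or_gt_of_ne hmn with h | h
  · exact hn.2 m h hm.1
  · exact hm.2 n h hn.1

theorem mem_hitSet_zero {x y : ℤ} {ω : Sample} : ω ∈ hitSet x y 0 ↔ x = y := by
  simp [hitSet, jumpChain_zero]

theorem notMem_hitSet_self_succ {y : ℤ} {n : ℕ} {ω : Sample} : ω ∉ hitSet y y (n + 1) :=
  fun h => h.2 0 n.succ_pos (jumpChain_zero y ω)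

theorem seqCons_mem_hitSet {x y : ℤ} (hxy : x ≠ y) {n : ℕ} {a : ℤ × ℝ≥0} {ω : Sample} :
    seqCons a ω ∈ hitSet x y (n + 1) ↔ ω ∈ hitSet (x + a.1) y n := by
  simp only [hitSet, Set.mem_ofPred_eq, jumpChain_seqCons]
  refine and_congr_right fun _ => ⟨fun h m hm => ?_, fun h m hm => ?_⟩
  · rw [← jumpChain_seqCons]
    exact h (m + 1) (by omega)
  · cases m with
    | zero => rwa [jumpChain_zero]
    | succ m => rw [jumpChain_seqCons]; exact h m (by omega)

/-- The cost `∑ c(S_i) τ_i` collected during the first `n` steps of the walk started at `x`. -/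
def cost (c : ℤ → ℝ≥0) (x : ℤ) (n : ℕ) (ω : Sample) : ℝ :=
  ∑ i ∈ Finset.range n, (c (jumpChain x i ω) : ℝ) * (ω i).2

theorem cost_seqCons (c : ℤ → ℝ≥0) (x : ℤ) (n : ℕ) (a : ℤ × ℝ≥0) (ω : Sample) :
    cost c x (n + 1) (seqCons a ω) = c x * a.2 + cost c (x + a.1) n ω := by
  simp only [cost, Finset.sum_range_succ', seqCons_succ, seqCons_zero, jumpChain_seqCons,
    jumpChain_zero]
  ring

theorem measurable_cost (c : ℤ → ℝ≥0) (x : ℤ) (n : ℕ) : Measurable (cost c x n) := by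
  unfold cost
  refine Finset.measurable_sum _ fun i _ => ?_
  have h1 : Measurable fun ω => (c (jumpChain x i ω) : ℝ) :=
    (Measurable.of_discrete (f := fun z => (c z : ℝ))).comp (measurable_jumpChain x i)
  fun_prop

theorem measurable_exp_neg_cost (c : ℤ → ℝ≥0) (x : ℤ) (n : ℕ) :
    Measurable fun ω => ENNReal.ofReal (Real.exp (-cost c x n ω)) :=
  (measurable_cost c x n).neg.exp.ennreal_ofReal

/-- Keep the first `n` entries and replace all later ones by a zero increment and a unit holding
time. -/
def truncate (n : ℕ) (ω : Sample) : Sample := fun i => if i < n then ω i else (0, 1)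

theorem truncate_apply_of_lt {n i : ℕ} (h : i < n) (ω : Sample) : truncate n ω i = ω i := if_pos h

theorem measurable_truncate (n : ℕ) : Measurable (truncate n) := by
  refine measurable_pi_lambda _ fun i => ?_
  unfold truncate
  split_ifs
  · exact measurable_pi_apply i
  · exact measurable_const

theorem truncate_zero (ω : Sample) : truncate 0 ω = fun _ => (0, 1) := by
  funext i; simp [truncate]

theorem truncate_seqCons (n : ℕ) (a : ℤ × ℝ≥0) (ω : Sample) :
    truncate (n + 1) (seqCons a ω) = seqCons a (truncate n ω) := by
  funext i
  cases i <;> simp [truncate]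

theorem jumpChain_truncate {n m : ℕ} (h : m ≤ n) (x : ℤ) (ω : Sample) :
    jumpChain x m (truncate n ω) = jumpChain x m ω := by
  unfold jumpChain
  congr 1
  refine Finset.sum_congr rfl fun i hi => ?_
  rw [truncate_apply_of_lt (by have := Finset.mem_range.1 hi; omega)]

theorem truncate_mem_hitSet {x y : ℤ} {n : ℕ} {ω : Sample} :
    truncate n ω ∈ hitSet x y n ↔ ω ∈ hitSet x y n := by
  simp only [hitSet, Set.mem_ofPred_eq, jumpChain_truncate le_rfl]
  refine and_congr_right fun _ => forall₂_congr fun m hm => ?_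
  rw [jumpChain_truncate hm.le]

/-! ### Integrals under the untilted law -/

instance : IsProbabilityMeasure baseLaw := by unfold baseLaw; infer_instance

theorem lintegral_baseLaw {f : Sample → ℝ≥0∞} (hf : Measurable f) :
    ∫⁻ ω, f ω ∂baseLaw =
      ∫⁻ τ, (2⁻¹ * ∫⁻ ω, f (seqCons (1, τ) ω) ∂baseLaw +
        2⁻¹ * ∫⁻ ω, f (seqCons (-1, τ) ω) ∂baseLaw) ∂holdLaw := by
  have hm : Measurable fun a : ℤ × ℝ≥0 => ∫⁻ ω, f (seqCons a ω) ∂baseLaw :=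
    (hf.comp measurable_seqCons).lintegral_prod_right'
  have hm' : ∀ e : ℤ, Measurable fun τ : ℝ≥0 => ∫⁻ ω, f (seqCons (e, τ) ω) ∂baseLaw := fun e =>
    hm.comp measurable_prodMk_left
  have h := lintegral_infinitePi_seqCons (stepLaw.prod holdLaw) hf
  rw [← baseLaw] at h
  rw [h, lintegral_stepLaw_prod_holdLaw hm, lintegral_add_left ((hm' 1).const_mul _),
    lintegral_const_mul _ (hm' 1), lintegral_const_mul _ (hm' (-1))]

theorem lintegral_exp_holdLaw (r : ℝ≥0) :
    ∫⁻ τ : ℝ≥0, ENNReal.ofReal (Real.exp (-(r * τ))) ∂holdLaw = (1 + (r : ℝ≥0∞))⁻¹ := by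
  have hm : Measurable fun s : ℝ => ENNReal.ofReal (Real.exp (-(r * s))) := by fun_prop
  rw [lintegral_holdLaw hm]
  simp_rw [expDensity_mul_exp]
  rw [lintegral_expDensity (by positivity)]
  congr 1
  rw [ENNReal.ofReal_add zero_le_one (NNReal.coe_nonneg r), ENNReal.ofReal_one]
  simp

theorem measurable_hitSet_indicator {x y : ℤ} {n : ℕ} {f : Sample → ℝ≥0∞} (hf : Measurable f) :
    Measurable ((hitSet x y n).indicator f) :=
  hf.indicator (measurableSet_hitSet x y n)

theorem hitSet_indicator_seqCons {x y : ℤ} (hxy : x ≠ y) (n : ℕ) (a : ℤ × ℝ≥0)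
    (f : Sample → ℝ≥0∞) (ω : Sample) :
    (hitSet x y (n + 1)).indicator f (seqCons a ω) =
      (hitSet (x + a.1) y n).indicator (fun ω => f (seqCons a ω)) ω := by
  classical
  simp only [Set.indicator_apply, seqCons_mem_hitSet hxy]

theorem hitSet_indicator_self_succ {y : ℤ} (n : ℕ) (f : Sample → ℝ≥0∞) :
    (hitSet y y (n + 1)).indicator f = fun _ => 0 := by
  funext ω
  exact Set.indicator_of_notMem notMem_hitSet_self_succ f

theorem hitSet_indicator_zero (x y : ℤ) (f : Sample → ℝ≥0∞) (ω : Sample) :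
    (hitSet x y 0).indicator f ω = if x = y then f ω else 0 := by
  classical
  simp only [Set.indicator_apply, mem_hitSet_zero]

/-- Conditioning on the first step, the holding time at `x` contributes its Laplace transform `(1 +
c x)⁻¹`, which is the discount in `passTerm`. -/
theorem lintegral_cost_baseLaw (c : ℤ → ℝ≥0) (x y : ℤ) (n : ℕ) :
    ∫⁻ ω, (hitSet x y n).indicator (fun ω => ENNReal.ofReal (Real.exp (-cost c x n ω))) ω ∂baseLaw =
      passTerm c y n x := by
  induction n generalizing x with
  | zero =>
    simp_rw [hitSet_indicator_zero, passTerm_zero]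
    split_ifs <;> simp [cost]
  | succ n ih =>
    rw [passTerm_succ]
    split_ifs with h
    · subst h
      simp [hitSet_indicator_self_succ]
    · have hm := measurable_exp_neg_cost c
      rw [lintegral_baseLaw (measurable_hitSet_indicator (hm x (n + 1)))]
      simp_rw [hitSet_indicator_seqCons h, cost_seqCons, neg_add, Real.exp_add,
        ENNReal.ofReal_mul (Real.exp_nonneg _), ← sub_eq_add_neg]
      have : ∀ (e : ℤ) (τ : ℝ≥0), ∫⁻ ω, (hitSet (x + e) y n).indicator
          (fun ω => ENNReal.ofReal (Real.exp (-(c x * τ))) *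
            ENNReal.ofReal (Real.exp (-cost c (x + e) n ω))) ω ∂baseLaw =
          ENNReal.ofReal (Real.exp (-(c x * τ))) * passTerm c y n (x + e) := by
        intro e τ
        rw [← ih, ← lintegral_const_mul _ (measurable_hitSet_indicator (hm _ _))]
        simp_rw [Set.indicator_const_mul]
      have h1 := this 1
      have h2 := this (-1)
      simp_rw [← sub_eq_add_neg] at h2
      simp_rw [h1, h2]
      rw [← lintegral_exp_holdLaw, ← lintegral_mul_const _ (by fun_prop)]
      refine lintegral_congr fun τ => ?_
      ring

/-! ### The Doob-transformed walk and its path density -/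

/-- The density of one step of the tilted walk at `z` with respect to a step of simple random
walk. -/
def jumpDensity (c : ℤ → ℝ≥0) (z : ℤ) (a : ℤ × ℝ≥0) : ℝ≥0∞ :=
  ENNReal.ofReal (Real.exp (-(c z * a.2))) *
    if a.1 = 1 then (passSum c z (z + 1))⁻¹ else passSum c (z - 1) z

theorem measurable_jumpDensity (c : ℤ → ℝ≥0) (z : ℤ) : Measurable (jumpDensity c z) := by
  unfold jumpDensity
  refine Measurable.mul (by fun_prop) ?_
  exact (Measurable.of_discrete (f := fun e : ℤ =>
    if e = 1 then (passSum c z (z + 1))⁻¹ else passSum c (z - 1) z)).comp measurable_fst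

/-- The law of one step of the tilted walk at `z`. -/
def jumpLaw (c : ℤ → ℝ≥0) (z : ℤ) : Measure (ℤ × ℝ≥0) :=
  (stepLaw.prod holdLaw).withDensity (jumpDensity c z)

theorem lintegral_jumpLaw (c : ℤ → ℝ≥0) (z : ℤ) {f : ℤ × ℝ≥0 → ℝ≥0∞} (hf : Measurable f) :
    ∫⁻ a, f a ∂jumpLaw c z =
      ∫⁻ τ : ℝ≥0, ENNReal.ofReal (Real.exp (-(c z * τ))) *
        (2⁻¹ * (passSum c z (z + 1))⁻¹ * f (1, τ) + 2⁻¹ * passSum c (z - 1) z * f (-1, τ))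
        ∂holdLaw := by
  have hd := measurable_jumpDensity c z
  have hm := hd.mul hf
  have hm' : ∀ e : ℤ, Measurable fun τ : ℝ≥0 => jumpDensity c z (e, τ) * f (e, τ) := fun e =>
    hm.comp measurable_prodMk_left
  rw [jumpLaw, lintegral_withDensity_eq_lintegral_mul _ hd hf, lintegral_stepLaw_prod_holdLaw hm]
  simp only [Pi.mul_apply]
  rw [← lintegral_const_mul _ (hm' 1), ← lintegral_const_mul _ (hm' (-1)),
    ← lintegral_add_left ((hm' 1).const_mul _)]
  refine lintegral_congr fun τ => ?_
  simp [jumpDensity]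
  ring

/-- The holding time contributes `(1 + c z)⁻¹` and the two directions contribute `1 + c z` by
`passSum_harmonic`. -/
instance (c : ℤ → ℝ≥0) (z : ℤ) : IsProbabilityMeasure (jumpLaw c z) := by
  refine ⟨?_⟩
  have h := lintegral_jumpLaw c z (f := fun _ => 1) measurable_const
  rw [lintegral_one] at h
  simp only [mul_one, passSum_harmonic] at h
  rw [h, lintegral_mul_const _ (by fun_prop), lintegral_exp_holdLaw]
  exact ENNReal.inv_mul_cancel (by simp) (by simp)

/-- The position after `n` steps of the chain that starts at `x` and at time `n` in `z` makes the
step `(s n z).1`. -/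
def stackChain (x : ℤ) (s : ℕ → ℤ → ℤ × ℝ≥0) : ℕ → ℤ
  | 0 => x
  | n + 1 => stackChain x s n + (s n (stackChain x s n)).1

/-- The sequence of increments and holding times read off from the stacks `s` by the chain started
at `x`. -/
def stackSample (x : ℤ) (s : ℕ → ℤ → ℤ × ℝ≥0) : Sample := fun n => s n (stackChain x s n)

theorem stackChain_seqCons (x : ℤ) (b : ℤ → ℤ × ℝ≥0) (s : ℕ → ℤ → ℤ × ℝ≥0) (n : ℕ) :
    stackChain x (seqCons b s) (n + 1) = stackChain (x + (b x).1) s n := by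
  induction n with
  | zero => rfl
  | succ n ih => rw [stackChain, ih, seqCons_succ, stackChain]

theorem stackSample_seqCons (x : ℤ) (b : ℤ → ℤ × ℝ≥0) (s : ℕ → ℤ → ℤ × ℝ≥0) :
    stackSample x (seqCons b s) = seqCons (b x) (stackSample (x + (b x).1) s) := by
  funext n
  cases n with
  | zero => rfl
  | succ n => simp only [stackSample, stackChain_seqCons, seqCons_succ]

theorem measurable_eval_stack (n : ℕ) :
    Measurable fun p : ℤ × (ℕ → ℤ → ℤ × ℝ≥0) => p.2 n p.1 :=
  measurable_from_prod_countable_right fun z =>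
    (measurable_pi_apply z).comp (measurable_pi_apply n)

theorem measurable_stackChain (x : ℤ) (n : ℕ) : Measurable fun s => stackChain x s n := by
  induction n with
  | zero => exact measurable_const
  | succ n ih =>
    exact ih.add (measurable_fst.comp ((measurable_eval_stack n).comp (ih.prodMk measurable_id)))

theorem measurable_stackSample (x : ℤ) : Measurable (stackSample x) :=
  measurable_pi_lambda _ fun n =>
    (measurable_eval_stack n).comp ((measurable_stackChain x n).prodMk measurable_id)

/-- The law of independent stacks, in which the entries at `z` have law `jumpLaw c z`. -/
def stackLaw (c : ℤ → ℝ≥0) : Measure (ℕ → ℤ → ℤ × ℝ≥0) :=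
  Measure.infinitePi fun _ : ℕ => Measure.infinitePi fun z => jumpLaw c z

instance (c : ℤ → ℝ≥0) : IsProbabilityMeasure (stackLaw c) := by unfold stackLaw; infer_instance

/-- The law of the increments and holding times of the tilted walk started at `x`. -/
def tiltedLaw (c : ℤ → ℝ≥0) (x : ℤ) : Measure Sample := (stackLaw c).map (stackSample x)

instance (c : ℤ → ℝ≥0) (x : ℤ) : IsProbabilityMeasure (tiltedLaw c x) :=
  Measure.isProbabilityMeasure_map (measurable_stackSample x).aemeasurable

/-- Reading a Markov chain off independent stacks requires only product measures. At time `0` just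
the entry at `x` is read; the later stacks are independent of it and drive the walk from its new
position. -/
theorem lintegral_tiltedLaw (c : ℤ → ℝ≥0) (x : ℤ) {f : Sample → ℝ≥0∞} (hf : Measurable f) :
    ∫⁻ ω, f ω ∂tiltedLaw c x =
      ∫⁻ τ : ℝ≥0, ENNReal.ofReal (Real.exp (-(c x * τ))) *
        (2⁻¹ * (passSum c x (x + 1))⁻¹ * ∫⁻ ω, f (seqCons (1, τ) ω) ∂tiltedLaw c (x + 1) +
          2⁻¹ * passSum c (x - 1) x * ∫⁻ ω, f (seqCons (-1, τ) ω) ∂tiltedLaw c (x - 1))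
        ∂holdLaw := by
  have hS : Measurable fun p : ℤ × (ℕ → ℤ → ℤ × ℝ≥0) => stackSample p.1 p.2 :=
    measurable_from_prod_countable_right measurable_stackSample
  have hF : Measurable fun a : ℤ × ℝ≥0 =>
      ∫⁻ s, f (seqCons a (stackSample (x + a.1) s)) ∂stackLaw c := by
    refine Measurable.lintegral_prod_right' (f := fun p : (ℤ × ℝ≥0) × (ℕ → ℤ → ℤ × ℝ≥0) =>
      f (seqCons p.1 (stackSample (x + p.1.1) p.2))) ?_
    have h : Measurable fun p : (ℤ × ℝ≥0) × (ℕ → ℤ → ℤ × ℝ≥0) => (x + p.1.1, p.2) := by fun_prop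
    exact hf.comp (measurable_seqCons.comp (measurable_fst.prodMk (hS.comp h)))
  have hmap : ∀ (z : ℤ) (a : ℤ × ℝ≥0), ∫⁻ ω, f (seqCons a ω) ∂tiltedLaw c z =
      ∫⁻ s, f (seqCons a (stackSample z s)) ∂stackLaw c := fun z a =>
    lintegral_map (hf.comp (measurable_seqCons.comp measurable_prodMk_left))
      (measurable_stackSample z)
  have h1 := lintegral_infinitePi_seqCons (Measure.infinitePi fun z => jumpLaw c z)
    (hf.comp (measurable_stackSample x))
  rw [← stackLaw] at h1
  rw [tiltedLaw, lintegral_map hf (measurable_stackSample x)]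
  refine h1.trans ?_
  simp only [Function.comp, stackSample_seqCons]
  have h2 := lintegral_map (μ := Measure.infinitePi fun z => jumpLaw c z) hF (measurable_pi_apply x)
  rw [Measure.infinitePi_map_eval] at h2
  rw [← h2, lintegral_jumpLaw c x hF]
  simp only [hmap, sub_eq_add_neg]

/-- The change of measure. Along a path from `x` to `y` the ratios in `jumpDensity` telescope to
`(passSum c x y)⁻¹`, and the exponential factors multiply to `exp (-cost)`. Truncation restricts the
test function to the `n` steps for which the density is computed. -/
theorem lintegral_hitSet_tiltedLaw (c : ℤ → ℝ≥0) {x y : ℤ} (hxy : x ≤ y) (n : ℕ)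
    {f : Sample → ℝ≥0∞} (hf : Measurable f) :
    ∫⁻ ω, (hitSet x y n).indicator (fun ω => f (truncate n ω)) ω ∂tiltedLaw c x =
      (passSum c x y)⁻¹ * ∫⁻ ω, (hitSet x y n).indicator
        (fun ω => ENNReal.ofReal (Real.exp (-cost c x n ω)) * f (truncate n ω)) ω ∂baseLaw := by
  induction n generalizing x f with
  | zero =>
    simp_rw [hitSet_indicator_zero, truncate_zero]
    split_ifs with h
    · subst h
      simp [cost, passSum_self]
    · simp
  | succ n ih =>
    rcases eq_or_lt_of_le hxy with rfl | hlt
    · simp [hitSet_indicator_self_succ]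
    have hft : ∀ n, Measurable fun ω => f (truncate n ω) := fun n => hf.comp (measurable_truncate n)
    have hfc : ∀ a : ℤ × ℝ≥0, Measurable fun ω => f (seqCons a ω) := fun a =>
      hf.comp (measurable_seqCons.comp measurable_prodMk_left)
    have hm := measurable_exp_neg_cost c
    have hJm : ∀ e : ℤ, Measurable fun p : ℝ≥0 × Sample => (hitSet (x + e) y n).indicator
        (fun ω => ENNReal.ofReal (Real.exp (-cost c (x + e) n ω)) *
          f (seqCons (e, p.1) (truncate n ω))) p.2 := by
      intro e
      have hg : Measurable fun p : ℝ≥0 × Sample =>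
          ENNReal.ofReal (Real.exp (-cost c (x + e) n p.2)) *
            f (seqCons (e, p.1) (truncate n p.2)) := by
        refine ((hm (x + e) n).comp measurable_snd).mul (hf.comp (measurable_seqCons.comp
          (Measurable.prodMk (by fun_prop) ((measurable_truncate n).comp measurable_snd))))
      exact hg.indicator (measurable_snd (measurableSet_hitSet (x + e) y n))
    have hbase : ∀ (e : ℤ) (τ : ℝ≥0), ∫⁻ ω, (hitSet (x + e) y n).indicator
          (fun ω => ENNReal.ofReal (Real.exp (-(c x * τ))) *
            ENNReal.ofReal (Real.exp (-cost c (x + e) n ω)) * f (seqCons (e, τ) (truncate n ω))) ω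
            ∂baseLaw =
          ENNReal.ofReal (Real.exp (-(c x * τ))) * ∫⁻ ω, (hitSet (x + e) y n).indicator
          (fun ω => ENNReal.ofReal (Real.exp (-cost c (x + e) n ω)) *
            f (seqCons (e, τ) (truncate n ω))) ω ∂baseLaw := by
      intro e τ
      have hJe : Measurable ((hitSet (x + e) y n).indicator fun ω =>
          ENNReal.ofReal (Real.exp (-cost c (x + e) n ω)) * f (seqCons (e, τ) (truncate n ω))) :=
        (hJm e).comp measurable_prodMk_left
      rw [← lintegral_const_mul _ hJe]
      simp_rw [mul_assoc, Set.indicator_const_mul]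
    have hb1 := hbase 1
    have hb2 := hbase (-1)
    -- One factor of the telescoping product, for a step up; `hZ2` is the same for a step down.
    have hZ1 : (passSum c x (x + 1))⁻¹ * (passSum c (x + 1) y)⁻¹ = (passSum c x y)⁻¹ := by
      rw [← passSum_mul_passSum c (show x ≤ x + 1 by omega) (show x + 1 ≤ y by omega),
        ENNReal.mul_inv (Or.inl (passSum_ne_zero c (by omega)))
          (Or.inl (passSum_ne_top c (by omega)))]
    have hZ2 : passSum c (x - 1) x * (passSum c (x - 1) y)⁻¹ = (passSum c x y)⁻¹ := by
      have h0 := passSum_ne_zero c (show x - 1 ≤ x by omega)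
      have ht := passSum_ne_top c (show x - 1 ≤ x by omega)
      rw [← passSum_mul_passSum c (show x - 1 ≤ x by omega) hxy,
        ENNReal.mul_inv (Or.inl h0) (Or.inl ht), ← mul_assoc, ENNReal.mul_inv_cancel h0 ht, one_mul]
    have ih1 := fun τ : ℝ≥0 => ih (x := x + 1) (by omega) (hfc (1, τ))
    have ih2 := fun τ : ℝ≥0 => ih (x := x - 1) (by omega) (hfc (-1, τ))
    have hW : Measurable fun ω =>
        ENNReal.ofReal (Real.exp (-cost c x (n + 1) ω)) * f (truncate (n + 1) ω) :=
      (hm x (n + 1)).mul (hft (n + 1))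
    rw [lintegral_tiltedLaw c x (measurable_hitSet_indicator (hft (n + 1))),
      lintegral_baseLaw (measurable_hitSet_indicator hW)]
    simp_rw [hitSet_indicator_seqCons hlt.ne, cost_seqCons, truncate_seqCons, neg_add,
      Real.exp_add, ENNReal.ofReal_mul (Real.exp_nonneg _), ← sub_eq_add_neg]
    simp_rw [← sub_eq_add_neg] at hb2
    simp_rw [hb1, hb2, ih1, ih2]
    have hJ1 : Measurable fun τ : ℝ≥0 => ∫⁻ ω, (hitSet (x + 1) y n).indicator
          (fun ω => ENNReal.ofReal (Real.exp (-cost c (x + 1) n ω)) *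
            f (seqCons (1, τ) (truncate n ω))) ω ∂baseLaw := (hJm 1).lintegral_prod_right'
    have hJ2 : Measurable fun τ : ℝ≥0 => ∫⁻ ω, (hitSet (x - 1) y n).indicator
          (fun ω => ENNReal.ofReal (Real.exp (-cost c (x - 1) n ω)) *
            f (seqCons (-1, τ) (truncate n ω))) ω ∂baseLaw := by
      simpa only [← sub_eq_add_neg] using (hJm (-1)).lintegral_prod_right' (ν := baseLaw)
    rw [← lintegral_const_mul _ (by fun_prop)]
    refine lintegral_congr fun τ => ?_
    rw [show ∀ A B : ℝ≥0∞, 2⁻¹ * (passSum c x (x + 1))⁻¹ * ((passSum c (x + 1) y)⁻¹ * A) +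
        2⁻¹ * passSum c (x - 1) x * ((passSum c (x - 1) y)⁻¹ * B) =
        2⁻¹ * ((passSum c x (x + 1))⁻¹ * (passSum c (x + 1) y)⁻¹) * A +
        2⁻¹ * (passSum c (x - 1) x * (passSum c (x - 1) y)⁻¹) * B from fun A B => by ring, hZ1, hZ2]
    ring

theorem measure_hitSet_tiltedLaw (c : ℤ → ℝ≥0) {x y : ℤ} (hxy : x ≤ y) (n : ℕ) :
    tiltedLaw c x (hitSet x y n) = (passSum c x y)⁻¹ * passTerm c y n x := by
  have h := lintegral_hitSet_tiltedLaw c hxy n (f := fun _ => 1) measurable_const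
  simp only [mul_one, lintegral_cost_baseLaw] at h
  rw [← h]
  exact (lintegral_indicator_one (measurableSet_hitSet x y n)).symm

/-- The first-hit probabilities are the terms of `passSum c x y` divided by their sum. -/
theorem ae_exists_mem_hitSet_tiltedLaw (c : ℤ → ℝ≥0) {x y : ℤ} (hxy : x ≤ y) :
    ∀ᵐ ω ∂tiltedLaw c x, ∃ n, ω ∈ hitSet x y n := by
  have hU : MeasurableSet (⋃ n, hitSet x y n) := MeasurableSet.iUnion (measurableSet_hitSet x y)
  have h : tiltedLaw c x (⋃ n, hitSet x y n) = 1 := by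
    rw [measure_iUnion (pairwise_disjoint_hitSet x y) (measurableSet_hitSet x y)]
    simp_rw [measure_hitSet_tiltedLaw c hxy]
    rw [ENNReal.tsum_mul_left]
    exact ENNReal.inv_mul_cancel (passSum_ne_zero c hxy) (passSum_ne_top c hxy)
  have h2 := (prob_compl_eq_zero_iff hU).2 h
  rw [ae_iff]
  convert h2 using 2
  ext ω
  simp

/-- With `c = 0` the first-hit probabilities are the terms of `passSum 0 x y`, which sum to `1` by
recurrence. -/
theorem ae_exists_mem_hitSet_baseLaw {x y : ℤ} (hxy : x ≤ y) :
    ∀ᵐ ω ∂baseLaw, ∃ n, ω ∈ hitSet x y n := by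
  have hU : MeasurableSet (⋃ n, hitSet x y n) := MeasurableSet.iUnion (measurableSet_hitSet x y)
  have h : baseLaw (⋃ n, hitSet x y n) = 1 := by
    rw [measure_iUnion (pairwise_disjoint_hitSet x y) (measurableSet_hitSet x y),
      ← passSum_zero hxy, passSum]
    refine tsum_congr fun n => ?_
    rw [← lintegral_cost_baseLaw, ← lintegral_indicator_one (measurableSet_hitSet x y n)]
    refine lintegral_congr fun ω => ?_
    congr 1
    funext ω
    simp [cost]
  have h2 := (prob_compl_eq_zero_iff hU).2 h
  rw [ae_iff]
  convert h2 using 2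
  ext ω
  simp

theorem ae_pos_baseLaw : ∀ᵐ ω ∂baseLaw, ∀ i, 0 < (ω i).2 := by
  rw [ae_all_iff]
  intro i
  have h1 : ∀ᵐ a ∂(stepLaw.prod holdLaw), 0 < a.2 := by
    have h : ∀ᵐ τ ∂holdLaw, 0 < τ := by
      rw [ae_iff]
      convert holdLaw_singleton_zero using 2
      ext τ
      simp
    exact Measure.quasiMeasurePreserving_snd.ae h
  exact (measurePreserving_eval_infinitePi
    (fun _ : ℕ => stepLaw.prod holdLaw) i).quasiMeasurePreserving.ae h1

theorem ae_pos_tiltedLaw (c : ℤ → ℝ≥0) (x : ℤ) : ∀ᵐ ω ∂tiltedLaw c x, ∀ i, 0 < (ω i).2 := by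
  have h1 : ∀ z, ∀ᵐ a ∂jumpLaw c z, 0 < a.2 := by
    intro z
    have h : ∀ᵐ τ ∂holdLaw, 0 < τ := by
      rw [ae_iff]
      convert holdLaw_singleton_zero using 2
      ext τ
      simp
    exact (withDensity_absolutelyContinuous _ _).ae_le (Measure.quasiMeasurePreserving_snd.ae h)
  have h2 : ∀ᵐ s ∂stackLaw c, ∀ (i : ℕ) (z : ℤ), 0 < (s i z).2 := by
    rw [ae_all_iff]
    intro i
    rw [ae_all_iff]
    intro z
    have h3 := (measurePreserving_eval_infinitePi (jumpLaw c) z).quasiMeasurePreserving.ae (h1 z)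
    exact (measurePreserving_eval_infinitePi
      (fun _ : ℕ => Measure.infinitePi fun z => jumpLaw c z) i).quasiMeasurePreserving.ae h3
  have hset : MeasurableSet {ω : Sample | ∀ i, 0 < (ω i).2} := by
    have : {ω : Sample | ∀ i, 0 < (ω i).2} = ⋂ i, {ω : Sample | 0 < (ω i).2} := by ext; simp
    rw [this]
    exact MeasurableSet.iInter fun i => measurableSet_lt measurable_const (by fun_prop)
  rw [tiltedLaw, ae_map_iff (measurable_stackSample x).aemeasurable hset]
  filter_upwards [h2] with s hs i
  exact hs i _

/-! ### Path structure, hitting times and the two σ-algebras -/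

/-- The time of the `n`-th jump. -/
def holdSum (n : ℕ) (ω : Sample) : ℝ≥0 := ∑ i ∈ Finset.range n, (ω i).2

theorem holdSum_zero (ω : Sample) : holdSum 0 ω = 0 := by simp [holdSum]

theorem holdSum_succ (n : ℕ) (ω : Sample) : holdSum (n + 1) ω = holdSum n ω + (ω n).2 :=
  Finset.sum_range_succ _ _

theorem holdSum_seqCons (n : ℕ) (a : ℤ × ℝ≥0) (ω : Sample) :
    holdSum (n + 1) (seqCons a ω) = a.2 + holdSum n ω := by
  simp only [holdSum, Finset.sum_range_succ', seqCons_succ, seqCons_zero]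
  ring

theorem measurable_holdSum (n : ℕ) : Measurable (holdSum n) := by
  unfold holdSum
  fun_prop

theorem holdSum_mono (ω : Sample) : Monotone fun n => holdSum n ω :=
  monotone_nat_of_le_succ fun n => by rw [holdSum_succ]; exact le_self_add

theorem holdSum_lt_succ {ω : Sample} (hpos : ∀ i, 0 < (ω i).2) (n : ℕ) :
    holdSum n ω < holdSum (n + 1) ω := by
  rw [holdSum_succ]
  exact lt_add_of_pos_right _ (hpos n)

theorem exists_holdSum_le_lt {ω : Sample} {n : ℕ} {s : ℝ≥0} (h : s < holdSum n ω) :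
    ∃ k < n, holdSum k ω ≤ s ∧ s < holdSum (k + 1) ω := by
  classical
  have hex : ∃ m, s < holdSum m ω := ⟨n, h⟩
  have hle := Nat.find_min' hex h
  have hspec := Nat.find_spec hex
  have hmin := fun m => Nat.find_min hex (m := m)
  rcases hm : Nat.find hex with _ | k
  · rw [hm, holdSum_zero] at hspec
    exact absurd hspec (by simp)
  · rw [hm] at hle hspec hmin
    exact ⟨k, by omega, not_lt.1 (hmin k (by omega)), hspec⟩

theorem jumpCount_eq {ω : Sample} {k : ℕ} {s : ℝ≥0} (h1 : holdSum k ω ≤ s)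
    (h2 : s < holdSum (k + 1) ω) : jumpCount s ω = k := by
  have : {m : ℕ | ∑ i ∈ Finset.range m, (ω i).2 ≤ s} = Set.Iic k := by
    ext m
    change holdSum m ω ≤ s ↔ m ≤ k
    refine ⟨fun h => ?_, fun h => (holdSum_mono ω h).trans h1⟩
    by_contra hk
    exact absurd (h2.trans_le (holdSum_mono ω (show k + 1 ≤ m by omega))) (not_lt.2 h)
  rw [jumpCount, this, csSup_Iic]

theorem walk_eq_jumpChain (x : ℤ) {ω : Sample} {k : ℕ} {s : ℝ≥0} (h1 : holdSum k ω ≤ s)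
    (h2 : s < holdSum (k + 1) ω) : walk x s ω = jumpChain x k ω := by
  rw [walk, jumpCount_eq h1 h2]

/-- The paths of the walk are right-continuous. -/
theorem exists_forall_walk_eq (x : ℤ) (t : ℝ≥0) (ω : Sample) :
    ∃ u > t, ∀ s, t ≤ s → s < u → walk x s ω = walk x t ω := by
  classical
  suffices ∃ u > t, ∀ s, t ≤ s → s < u → ∀ m, holdSum m ω ≤ s ↔ holdSum m ω ≤ t by
    obtain ⟨u, hu, h⟩ := this
    refine ⟨u, hu, fun s h1 h2 => ?_⟩
    have : {m : ℕ | ∑ i ∈ Finset.range m, (ω i).2 ≤ s} =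
        {m : ℕ | ∑ i ∈ Finset.range m, (ω i).2 ≤ t} := Set.ext (h s h1 h2)
    rw [walk, walk, jumpCount, jumpCount, this]
  by_cases hex : ∃ m, t < holdSum m ω
  · refine ⟨holdSum (Nat.find hex) ω, Nat.find_spec hex, fun s h1 h2 m =>
      ⟨fun h => ?_, fun h => h.trans h1⟩⟩
    have hm : m < Nat.find hex := by
      by_contra hm
      exact absurd ((h2.trans_le (holdSum_mono ω (not_lt.1 hm)))) (not_lt.2 h)
    exact not_lt.1 (Nat.find_min hex hm)
  · push Not at hex
    exact ⟨t + 1, by simp, fun s h1 _ m => ⟨fun _ => hex m, fun h => h.trans h1⟩⟩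

theorem hit_of_forall_ne {x y : ℤ} {ω : Sample} (h : ∀ s, walk x s ω ≠ y) : hit x y ω = ⊤ := by
  classical
  rw [hit, hittingAfter_def]
  exact if_neg (by simpa using h)

theorem exists_hit_eq {x y : ℤ} {ω : Sample} {s : ℝ≥0} (hs : walk x s ω = y) :
    ∃ r : ℝ≥0, hit x y ω = r ∧ r ≤ s ∧ walk x r ω = y := by
  classical
  set S : Set ℝ≥0 := {i | 0 ≤ i ∧ walk x i ω ∈ ({y} : Set ℤ)} with hS
  have hsS : s ∈ S := ⟨zero_le, hs⟩
  refine ⟨sInf S, ?_, csInf_le (OrderBot.bddBelow S) hsS, ?_⟩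
  · rw [hit, hittingAfter_def]
    exact if_pos ⟨s, zero_le, hs⟩
  · obtain ⟨u, hu, h⟩ := exists_forall_walk_eq x (sInf S) ω
    obtain ⟨j, hj, hju⟩ := exists_lt_of_csInf_lt ⟨s, hsS⟩ hu
    rw [← h j (csInf_le (OrderBot.bddBelow S) hj) hju]
    exact hj.2

theorem hit_le_iff {x y : ℤ} {ω : Sample} {t : ℝ≥0} :
    hit x y ω ≤ (t : WithTop ℝ≥0) ↔ ∃ s ≤ t, walk x s ω = y := by
  constructor
  · intro h
    by_cases hex : ∃ s, walk x s ω = y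
    · obtain ⟨s, hs⟩ := hex
      obtain ⟨r, hr, -, hry⟩ := exists_hit_eq hs
      rw [hr, WithTop.coe_le_coe] at h
      exact ⟨r, h, hry⟩
    · push Not at hex
      rw [hit_of_forall_ne hex] at h
      exact absurd h (not_le.2 (WithTop.coe_lt_top t))
  · rintro ⟨s, hst, hs⟩
    obtain ⟨r, hr, hrs, -⟩ := exists_hit_eq hs
    rw [hr, WithTop.coe_le_coe]
    exact hrs.trans hst

open scoped Classical in
theorem stoppedProcess_eq_ite (x y : ℤ) (t : ℝ≥0) (ω : Sample) :
    stoppedProcess (walk x) (hit x y) t ω =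
      if hit x y ω ≤ (t : WithTop ℝ≥0) then y else walk x t ω := by
  rw [stoppedProcess]
  split_ifs with h
  · obtain ⟨s, -, hs⟩ := hit_le_iff.1 h
    obtain ⟨r, hr, -, hry⟩ := exists_hit_eq hs
    rw [min_eq_right h, hr]
    exact hry
  · rw [min_eq_left (not_le.1 h).le]
    rfl

/-- A visit before `t` lasts for a positive time by right-continuity, so it is seen at a time in
`D`. This makes the event measurable for `walkSigma`. -/
theorem hit_le_iff_countable {D : Set ℝ≥0} (hD : Dense D) {x y : ℤ} {ω : Sample} {t : ℝ≥0} :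
    hit x y ω ≤ (t : WithTop ℝ≥0) ↔ walk x t ω = y ∨ ∃ q ∈ D, q ≤ t ∧ walk x q ω = y := by
  rw [hit_le_iff]
  constructor
  · rintro ⟨s, hst, hs⟩
    rcases eq_or_lt_of_le hst with rfl | hlt
    · exact Or.inl hs
    · obtain ⟨u, hu, h⟩ := exists_forall_walk_eq x s ω
      obtain ⟨q, hqD, hq1, hq2⟩ := hD.exists_between (lt_min hu hlt)
      exact Or.inr ⟨q, hqD, (hq2.trans_le (min_le_right _ _)).le,
        (h q hq1.le (hq2.trans_le (min_le_left _ _))).trans hs⟩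
  · rintro (h | ⟨q, -, hqt, hq⟩)
    · exact ⟨t, le_rfl, h⟩
    · exact ⟨q, hqt, hq⟩

theorem measurable_walk_walkSigma (x : ℤ) (t : ℝ≥0) : Measurable[walkSigma x] (walk x t) :=
  (comap_measurable (walk x t)).mono (le_iSup (fun t : ℝ≥0 => MeasurableSpace.comap (walk x t) ⊤) t)
    le_rfl

theorem measurableSet_hit_le_walkSigma (x y : ℤ) (t : ℝ≥0) :
    MeasurableSet[walkSigma x] {ω | hit x y ω ≤ (t : WithTop ℝ≥0)} := by
  obtain ⟨D, hDc, hD⟩ := TopologicalSpace.exists_countable_dense ℝ≥0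
  have h : {ω | hit x y ω ≤ (t : WithTop ℝ≥0)} =
      walk x t ⁻¹' {y} ∪ ⋃ q ∈ D, {_ω | q ≤ t} ∩ walk x q ⁻¹' {y} := by
    ext ω
    refine (hit_le_iff_countable hD).trans ?_
    simp [and_left_comm]
  have hm : ∀ q, MeasurableSet[walkSigma x] (walk x q ⁻¹' {y}) := fun q =>
    measurable_walk_walkSigma x q (measurableSet_singleton y)
  rw [h]
  let _ := walkSigma x
  exact (hm t).union (MeasurableSet.biUnion hDc fun q _ => (MeasurableSet.const _).inter (hm q))

theorem stoppedSigma_le_walkSigma (x y : ℤ) : stoppedSigma x y ≤ walkSigma x := by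
  classical
  refine iSup_le fun t => ?_
  rw [← measurable_iff_comap_le]
  have h : stoppedProcess (walk x) (hit x y) t =
      fun ω => if hit x y ω ≤ (t : WithTop ℝ≥0) then y else walk x t ω :=
    funext fun ω => stoppedProcess_eq_ite x y t ω
  rw [h]
  let _ := walkSigma x
  exact Measurable.ite (measurableSet_hit_le_walkSigma x y t) measurable_const
    (measurable_walk_walkSigma x t)

theorem measurableSet_hit_le_stoppedSigma (x y : ℤ) (t : ℝ≥0) :
    MeasurableSet[stoppedSigma x y] {ω | hit x y ω ≤ (t : WithTop ℝ≥0)} := by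
  have hm : Measurable[stoppedSigma x y] (stoppedProcess (walk x) (hit x y) t) :=
    (comap_measurable (stoppedProcess (walk x) (hit x y) t)).mono
      (le_iSup (fun t : ℝ≥0 =>
        MeasurableSpace.comap (stoppedProcess (walk x) (hit x y) t) ⊤) t) le_rfl
  have h : {ω | hit x y ω ≤ (t : WithTop ℝ≥0)} = stoppedProcess (walk x) (hit x y) t ⁻¹' {y} := by
    ext ω
    simp only [Set.mem_preimage, Set.mem_singleton_iff, stoppedProcess_eq_ite, Set.mem_ofPred_eq]
    split_ifs with h
    · exact iff_of_true h rfl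
    · refine iff_of_false h fun hw => h (hit_le_iff.2 ⟨t, le_rfl, hw⟩)
  rw [h]
  exact hm (measurableSet_singleton y)

theorem measurable_jumpCount (t : ℝ≥0) : Measurable (jumpCount t) := by
  have hle : ∀ m, MeasurableSet {ω : Sample | holdSum m ω ≤ t} := fun m =>
    measurableSet_le (measurable_holdSum m) measurable_const
  refine measurable_to_countable' fun k => ?_
  -- The second set accounts for `sSup` being `0` on the unbounded set that arises when all jump
  -- times are at most `t`.
  have h : jumpCount t ⁻¹' {k} =
      ({ω | holdSum k ω ≤ t} ∩ {ω | holdSum (k + 1) ω ≤ t}ᶜ) ∪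
        ((⋂ m, {ω | holdSum m ω ≤ t}) ∩ {_ω | k = 0}) := by
    ext ω
    simp only [Set.mem_preimage, Set.mem_singleton_iff, Set.mem_union, Set.mem_inter_iff,
      Set.mem_compl_iff, Set.mem_iInter, Set.mem_ofPred_eq, not_le]
    by_cases hall : ∀ m, holdSum m ω ≤ t
    · have h0 : jumpCount t ω = 0 := by
        have : {m : ℕ | ∑ i ∈ Finset.range m, (ω i).2 ≤ t} = Set.univ :=
          Set.eq_univ_of_forall hall
        rw [jumpCount, this]
        exact Nat.sSup_of_not_bddAbove not_bddAbove_univ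
      rw [h0]
      have := hall (k + 1)
      grind
    · have hall' := hall
      push Not at hall'
      obtain ⟨m, hm⟩ := hall'
      obtain ⟨j, -, h1, h2⟩ := exists_holdSum_le_lt hm
      rw [jumpCount_eq h1 h2]
      constructor
      · rintro rfl
        exact Or.inl ⟨h1, h2⟩
      · rintro (⟨h3, h4⟩ | ⟨h3, -⟩)
        · rw [← jumpCount_eq h1 h2, jumpCount_eq h3 h4]
        · exact absurd h3 hall
  rw [h]
  exact ((hle k).inter (hle (k + 1)).compl).union
    ((MeasurableSet.iInter hle).inter (MeasurableSet.const _))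

theorem measurable_walk (x : ℤ) (t : ℝ≥0) : Measurable (walk x t) := by
  have h : Measurable fun p : ℕ × Sample => jumpChain x p.1 p.2 :=
    measurable_from_prod_countable_right fun n => measurable_jumpChain x n
  exact h.comp ((measurable_jumpCount t).prodMk measurable_id)

theorem walkSigma_le (x : ℤ) : walkSigma x ≤ MeasurableSpace.pi :=
  iSup_le fun t => (measurable_walk x t).comap_le

/-- Positive holding times ensure that the walk really spends time at each site of the jump chain; a
zero holding time could make it skip the visit to `y`. -/
theorem hit_eq_holdSum {x y : ℤ} {n : ℕ} {ω : Sample} (hpos : ∀ i, 0 < (ω i).2)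
    (hω : ω ∈ hitSet x y n) : hit x y ω = holdSum n ω := by
  have h1 : walk x (holdSum n ω) ω = y :=
    (walk_eq_jumpChain x le_rfl (holdSum_lt_succ hpos n)).trans hω.1
  obtain ⟨r, hr, hrs, hry⟩ := exists_hit_eq h1
  rcases eq_or_lt_of_le hrs with rfl | hlt
  · exact hr
  · obtain ⟨k, hk, h2, h3⟩ := exists_holdSum_le_lt hlt
    rw [walk_eq_jumpChain x h2 h3] at hry
    exact absurd hry (hω.2 k hk)

theorem holdSum_truncate {n m : ℕ} (h : m ≤ n) (ω : Sample) :
    holdSum m (truncate n ω) = holdSum m ω := by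
  unfold holdSum
  refine Finset.sum_congr rfl fun i hi => ?_
  rw [truncate_apply_of_lt (by have := Finset.mem_range.1 hi; omega)]

theorem truncate_pos {ω : Sample} (hpos : ∀ i, 0 < (ω i).2) (n i : ℕ) :
    0 < (truncate n ω i).2 := by
  unfold truncate
  split_ifs
  · exact hpos i
  · exact one_pos

/-- Truncation after the hitting step does not change the stopped walk. -/
theorem stoppedProcess_truncate {x y : ℤ} {n : ℕ} {ω : Sample} (hpos : ∀ i, 0 < (ω i).2)
    (hω : ω ∈ hitSet x y n) (t : ℝ≥0) :
    stoppedProcess (walk x) (hit x y) t (truncate n ω) =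
      stoppedProcess (walk x) (hit x y) t ω := by
  rw [stoppedProcess_eq_ite, stoppedProcess_eq_ite, hit_eq_holdSum hpos hω,
    hit_eq_holdSum (truncate_pos hpos n) (truncate_mem_hitSet.2 hω), holdSum_truncate le_rfl]
  split_ifs with h
  · rfl
  · rw [WithTop.coe_le_coe, not_le] at h
    obtain ⟨k, hk, h2, h3⟩ := exists_holdSum_le_lt h
    rw [walk_eq_jumpChain x h2 h3, walk_eq_jumpChain (k := k), jumpChain_truncate hk.le]
    · rwa [holdSum_truncate hk.le]
    · rwa [holdSum_truncate hk]

/-- Every event of `stoppedSigma x y` is a preimage under the whole stopped path, so it cannot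
separate samples with the same stopped path. -/
theorem mem_iff_of_stoppedProcess_eq {x y : ℤ} {A : Set Sample}
    (hA : MeasurableSet[stoppedSigma x y] A) {ω ω' : Sample}
    (h : ∀ t, stoppedProcess (walk x) (hit x y) t ω = stoppedProcess (walk x) (hit x y) t ω') :
    ω ∈ A ↔ ω' ∈ A := by
  have hle : stoppedSigma x y ≤
      MeasurableSpace.comap (fun ω t => stoppedProcess (walk x) (hit x y) t ω)
        (MeasurableSpace.pi (m := fun _ : ℝ≥0 => (⊤ : MeasurableSpace ℤ))) := by
    refine iSup_le fun t => ?_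
    rw [← measurable_iff_comap_le]
    exact (@measurable_pi_apply _ _ (fun _ => (⊤ : MeasurableSpace ℤ)) t).comp (comap_measurable _)
  obtain ⟨B, -, rfl⟩ := hle A hA
  simp only [Set.mem_preimage]
  rw [funext h]

theorem integral_Ico_holdSum (x : ℤ) (V : ℤ → ℝ) (ω : Sample) (n : ℕ) :
    IntegrableOn (fun s : ℝ => V (walk x s.toNNReal ω)) (Set.Ico 0 (holdSum n ω : ℝ)) ∧
    ∫ s in Set.Ico 0 (holdSum n ω : ℝ), V (walk x s.toNNReal ω) =
      ∑ i ∈ Finset.range n, V (jumpChain x i ω) * (ω i).2 := by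
  induction n with
  | zero => simp [holdSum_zero]
  | succ n ih =>
    have hle : (holdSum n ω : ℝ) ≤ holdSum (n + 1) ω := by
      exact_mod_cast holdSum_mono ω n.le_succ
    have hU : Set.Ico 0 (holdSum (n + 1) ω : ℝ) =
        Set.Ico 0 (holdSum n ω : ℝ) ∪ Set.Ico (holdSum n ω : ℝ) (holdSum (n + 1) ω) :=
      (Set.Ico_union_Ico_eq_Ico (NNReal.coe_nonneg _) hle).symm
    have hEq : Set.EqOn (fun s : ℝ => V (walk x s.toNNReal ω)) (fun _ => V (jumpChain x n ω))
        (Set.Ico (holdSum n ω : ℝ) (holdSum (n + 1) ω)) := by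
      intro s hs
      have h0 : 0 ≤ s := (NNReal.coe_nonneg _).trans hs.1
      simp only
      rw [walk_eq_jumpChain x (k := n)]
      · exact NNReal.coe_le_coe.1 (by rw [Real.coe_toNNReal s h0]; exact hs.1)
      · exact NNReal.coe_lt_coe.1 (by rw [Real.coe_toNNReal s h0]; exact hs.2)
    have hint : IntegrableOn (fun s : ℝ => V (walk x s.toNNReal ω))
        (Set.Ico (holdSum n ω : ℝ) (holdSum (n + 1) ω)) :=
      (integrableOn_congr_fun hEq measurableSet_Ico).2 (integrableOn_const (by simp))
    rw [hU]
    refine ⟨ih.1.union hint, ?_⟩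
    rw [setIntegral_union (Set.Ico_disjoint_Ico_same) measurableSet_Ico ih.1 hint, ih.2,
      setIntegral_congr_fun measurableSet_Ico hEq, Finset.sum_range_succ, setIntegral_const,
      holdSum_succ]
    simp [mul_comm]

theorem weight_eq {x y : ℤ} {n : ℕ} {ω : Sample} (hpos : ∀ i, 0 < (ω i).2)
    (hω : ω ∈ hitSet x y n) {ζ : ℤ → ℝ} {η : ℝ} {c : ℤ → ℝ≥0} (hc : ∀ z, (c z : ℝ) = -(ζ z + η)) :
    weight x y ζ η ω = ENNReal.ofReal (Real.exp (-cost c x n ω)) := by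
  have hset : {s : ℝ | 0 ≤ s ∧ (s.toNNReal : WithTop ℝ≥0) < hit x y ω} =
      Set.Ico 0 (holdSum n ω : ℝ) := by
    ext s
    rw [hit_eq_holdSum hpos hω]
    simp only [Set.mem_ofPred_eq, Set.mem_Ico, WithTop.coe_lt_coe]
    refine and_congr_right fun h0 => ?_
    rw [← NNReal.coe_lt_coe, Real.coe_toNNReal s h0]
  rw [weight, hset, (integral_Ico_holdSum x (fun z => ζ z + η) ω n).2, cost,
    ← Finset.sum_neg_distrib]
  congr 3
  funext i
  rw [hc]
  ring

/-! ### Existence of the tilted laws -/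

theorem lintegral_eq_tsum_hitSet {μ : Measure Sample} {x y : ℤ}
    (h : ∀ᵐ ω ∂μ, ∃ n, ω ∈ hitSet x y n) (f : Sample → ℝ≥0∞) :
    ∫⁻ ω, f ω ∂μ = ∑' n, ∫⁻ ω, (hitSet x y n).indicator f ω ∂μ := by
  have hU : ∫⁻ ω, f ω ∂μ = ∫⁻ ω in ⋃ n, hitSet x y n, f ω ∂μ := by
    rw [Measure.restrict_eq_self_of_ae_mem]
    filter_upwards [h] with ω hω
    simpa using hω
  rw [hU, lintegral_iUnion (measurableSet_hitSet x y) (pairwise_disjoint_hitSet x y)]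
  exact tsum_congr fun n => (lintegral_indicator (measurableSet_hitSet x y n) f).symm

theorem normConst_eq_passSum {x y : ℤ} (hxy : x ≤ y) {ζ : ℤ → ℝ} {η : ℝ} {c : ℤ → ℝ≥0}
    (hc : ∀ z, (c z : ℝ) = -(ζ z + η)) : normConst x y ζ η = passSum c x y := by
  rw [normConst, lintegral_eq_tsum_hitSet (ae_exists_mem_hitSet_baseLaw hxy), passSum]
  refine tsum_congr fun n => ?_
  rw [← lintegral_cost_baseLaw]
  refine lintegral_congr_ae ?_
  filter_upwards [ae_pos_baseLaw] with ω hpos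
  by_cases hω : ω ∈ hitSet x y n
  · rw [Set.indicator_of_mem hω, Set.indicator_of_mem hω, weight_eq hpos hω hc]
  · rw [Set.indicator_of_notMem hω, Set.indicator_of_notMem hω]

/-- Both sides are split according to the step at which `y` is first hit. There truncation does not
affect membership in `A`, so the change of measure applies to the indicator of `A`. -/
theorem tiltedLaw_apply {x y : ℤ} (hxy : x ≤ y) {ζ : ℤ → ℝ} {η : ℝ} {c : ℤ → ℝ≥0}
    (hc : ∀ z, (c z : ℝ) = -(ζ z + η)) {A : Set Sample} (hA : MeasurableSet[stoppedSigma x y] A) :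
    tiltedLaw c x A = stoppedTiltedProb x y ζ η A := by
  have hA' : MeasurableSet A := walkSigma_le x A (stoppedSigma_le_walkSigma x y A hA)
  have htrunc : ∀ {ω : Sample} {n : ℕ}, (∀ i, 0 < (ω i).2) → ω ∈ hitSet x y n →
      A.indicator (1 : Sample → ℝ≥0∞) (truncate n ω) = A.indicator 1 ω := by
    intro ω n hpos hω
    have h := mem_iff_of_stoppedProcess_eq hA (stoppedProcess_truncate hpos hω)
    classical
    simp only [Set.indicator_apply, h, Pi.one_apply]
  rw [stoppedTiltedProb, normConst_eq_passSum hxy hc, ← lintegral_indicator_one hA',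
    ← lintegral_indicator hA', lintegral_eq_tsum_hitSet (ae_exists_mem_hitSet_tiltedLaw c hxy),
    lintegral_eq_tsum_hitSet (ae_exists_mem_hitSet_baseLaw hxy), ← ENNReal.tsum_mul_left]
  refine tsum_congr fun n => ?_
  have h := lintegral_hitSet_tiltedLaw c hxy n
    (f := A.indicator 1) (measurable_one.indicator hA')
  refine Eq.trans (lintegral_congr_ae ?_) (h.trans ?_)
  · filter_upwards [ae_pos_tiltedLaw c x] with ω hpos
    by_cases hω : ω ∈ hitSet x y n
    · rw [Set.indicator_of_mem hω, Set.indicator_of_mem hω, htrunc hpos hω]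
    · rw [Set.indicator_of_notMem hω, Set.indicator_of_notMem hω]
  · congr 1
    refine lintegral_congr_ae ?_
    filter_upwards [ae_pos_baseLaw] with ω hpos
    by_cases hω : ω ∈ hitSet x y n
    · rw [Set.indicator_of_mem hω, Set.indicator_of_mem hω, htrunc hpos hω]
      by_cases hωA : ω ∈ A
      · rw [Set.indicator_of_mem hωA, Set.indicator_of_mem hωA, weight_eq hpos hω hc]
        simp
      · rw [Set.indicator_of_notMem hωA, Set.indicator_of_notMem hωA, mul_zero]
    · rw [Set.indicator_of_notMem hω, Set.indicator_of_notMem hω]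

theorem isTiltedLaw_trim (x : ℤ) {ζ : ℤ → ℝ} {η : ℝ} {c : ℤ → ℝ≥0}
    (hc : ∀ z, (c z : ℝ) = -(ζ z + η)) :
    IsTiltedLaw x ζ η ((tiltedLaw c x).trim (walkSigma_le x)) where
  isProbabilityMeasure :=
    @IsProbabilityMeasure.mk _ (walkSigma x) _ (by
      rw [trim_measurableSet_eq _ MeasurableSet.univ]
      exact measure_univ)
  eq_stopped z hz A hA := by
    rw [trim_measurableSet_eq _ (stoppedSigma_le_walkSigma x z A hA)]
    exact tiltedLaw_apply hz hc hA

/-! ### Renewal equations with different exponential rates -/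

/-- The resolvent identity `1/(λ+r) = 1/(λ+r+d) + d/((λ+r)(λ+r+d))`, read through Laplace
transforms. -/
theorem lconvolution_expDensity_self (r : ℝ) {d : ℝ} (hd : 0 ≤ d) (s : ℝ) :
    expDensity (r + d) s +
        ENNReal.ofReal d * lconvolution (expDensity r) (expDensity (r + d)) volume s =
      expDensity r s := by
  rw [lconvolution_def]
  rcases lt_or_ge s 0 with hs | hs
  · rw [expDensity_of_neg hs, expDensity_of_neg hs]
    have : ∀ y, expDensity r y * expDensity (r + d) (-y + s) = 0 := by
      intro y
      rcases lt_or_ge y 0 with hy | hy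
      · rw [expDensity_of_neg hy, zero_mul]
      · rw [expDensity_of_neg (show -y + s < 0 by linarith), mul_zero]
    simp [this]
  · have h1 : ∀ y, ENNReal.ofReal d * (expDensity r y * expDensity (r + d) (-y + s)) =
        (Set.Icc 0 s).indicator (fun y => ENNReal.ofReal (Real.exp (-((r + d) * s))) *
          ENNReal.ofReal (d * Real.exp (d * y))) y := by
      intro y
      by_cases hy : y ∈ Set.Icc 0 s
      · rw [Set.indicator_of_mem hy, expDensity_of_nonneg hy.1,
          expDensity_of_nonneg (show 0 ≤ -y + s by linarith [hy.2]),
          ← ENNReal.ofReal_mul (Real.exp_nonneg _), ← ENNReal.ofReal_mul hd,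
          ← ENNReal.ofReal_mul (Real.exp_nonneg _), ← Real.exp_add, mul_left_comm, ← Real.exp_add]
        congr 3
        ring
      · rw [Set.indicator_of_notMem hy]
        rcases lt_or_ge y 0 with hy0 | hy0
        · rw [expDensity_of_neg hy0, zero_mul, mul_zero]
        · have : s < y := by
            by_contra h
            exact hy ⟨hy0, not_lt.1 h⟩
          rw [expDensity_of_neg (show -y + s < 0 by linarith), mul_zero, mul_zero]
    have hcont : Continuous fun y : ℝ => d * Real.exp (d * y) := by fun_prop
    have h2 : ∫⁻ y in Set.Icc 0 s, ENNReal.ofReal (d * Real.exp (d * y)) =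
        ENNReal.ofReal (Real.exp (d * s) - 1) := by
      rw [← ofReal_integral_eq_lintegral_ofReal (hcont.integrableOn_Icc)
        (Filter.Eventually.of_forall fun y => mul_nonneg hd (Real.exp_nonneg _)),
        integral_Icc_eq_integral_Ioc, ← intervalIntegral.integral_of_le hs,
        intervalIntegral.integral_eq_sub_of_hasDerivAt (f := fun y => Real.exp (d * y))]
      · simp
      · intro y _
        have := ((hasDerivAt_id y).const_mul d).exp
        simpa [mul_comm] using this
      · exact hcont.intervalIntegrable _ _
    have hmeas : Measurable fun y => expDensity r y * expDensity (r + d) (-y + s) :=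
      (measurable_expDensity r).mul ((measurable_expDensity (r + d)).comp (by fun_prop))
    rw [← lintegral_const_mul _ hmeas]
    simp_rw [h1]
    rw [lintegral_indicator measurableSet_Icc, lintegral_const_mul _ (by fun_prop), h2,
      expDensity_of_nonneg hs, expDensity_of_nonneg hs, ← ENNReal.ofReal_mul (Real.exp_nonneg _),
      ← ENNReal.ofReal_add (Real.exp_nonneg _) (mul_nonneg (Real.exp_nonneg _)
        (sub_nonneg.2 (Real.one_le_exp (mul_nonneg hd hs)))), mul_sub, ← Real.exp_add, mul_one]
    congr 1
    rw [add_sub_cancel]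
    congr 1
    ring

/-- A solution of the renewal equation with rate `r + d` is a supersolution of the one with
rate `r`, if the source terms compare after moving the excess rate to the left. -/
theorem lconvolution_expDensity_le {r d : ℝ} (hr : 0 < r) (hd : 0 ≤ d) {q q' v : ℝ → ℝ≥0∞}
    (hq : Measurable q) (hq' : Measurable q')
    (hv : v = lconvolution (expDensity (r + d)) q' volume) (hv1 : ∀ s, v s ≤ 1)
    (hqq' : ∀ s, q s + ENNReal.ofReal d * v s ≤ q' s) (t : ℝ) :
    lconvolution (expDensity r) q volume t ≤ v t := by
  have he := measurable_expDensity
  have hvm : Measurable v := by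
    rw [hv]
    exact measurable_lconvolution _ (he _) hq'
  have hassoc : lconvolution (expDensity r) v volume =
      lconvolution (lconvolution (expDensity r) (expDensity (r + d)) volume) q' volume := by
    rw [hv, lconvolution_assoc (he _) (he _) hq']
  have hprod : ∀ {f g : ℝ → ℝ≥0∞}, Measurable f → Measurable g →
      Measurable fun y => f y * g (-y + t) := fun hf hg => hf.mul (hg.comp (by fun_prop))
  -- Write `e` for the kernel of rate `r`. The resolvent identity convolved with `q'` gives `e * q'
  -- = v + d (e * v)`, while the hypothesis gives `e * q + d (e * v) ≤ e * q'`. The common term `X`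
  -- is finite because `v ≤ 1`, so it cancels.
  set X := ENNReal.ofReal d * lconvolution (expDensity r) v volume t with hX
  have hXt : X ≠ ⊤ := by
    refine ENNReal.mul_ne_top ENNReal.ofReal_ne_top (ne_of_lt ?_)
    calc lconvolution (expDensity r) v volume t ≤ ∫⁻ s, expDensity r s * 1 :=
          lintegral_mono fun s => mul_le_mul_right (hv1 _) _
      _ = (ENNReal.ofReal r)⁻¹ := by simp only [mul_one, lintegral_expDensity hr]
      _ < ⊤ := by simpa using hr
  refine (ENNReal.add_le_add_iff_right hXt).1 ?_
  calc lconvolution (expDensity r) q volume t + X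
      = ∫⁻ y, expDensity r y * (q (-y + t) + ENNReal.ofReal d * v (-y + t)) := by
        rw [hX, lconvolution_def, lconvolution_def,
          ← lintegral_const_mul _ (hprod (he r) hvm),
          ← lintegral_add_left (hprod (he r) hq)]
        refine lintegral_congr fun y => ?_
        ring
    _ ≤ ∫⁻ y, expDensity r y * q' (-y + t) := lintegral_mono fun y => mul_le_mul_right (hqq' _) _
    _ = v t + X := by
        have hc : Measurable (lconvolution (expDensity r) (expDensity (r + d)) volume) :=
          measurable_lconvolution _ (he _) (he _)
        rw [hX, hassoc, hv, lconvolution_def, lconvolution_def,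
          ← lintegral_const_mul _ (hprod hc hq'),
          ← lintegral_add_left (hprod (he _) hq')]
        refine lintegral_congr fun y => ?_
        rw [← lconvolution_expDensity_self r hd y]
        ring

/-! ### Comparison of hitting probabilities -/

/-- The rate of jumps to the right of the tilted walk at `z`. -/
def rateUp (c : ℤ → ℝ≥0) (z : ℤ) : ℝ≥0∞ := 2⁻¹ * (passSum c z (z + 1))⁻¹

/-- The rate of jumps to the left of the tilted walk at `z`. -/
def rateDown (c : ℤ → ℝ≥0) (z : ℤ) : ℝ≥0∞ := 2⁻¹ * passSum c (z - 1) z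

theorem rateUp_add_rateDown (c : ℤ → ℝ≥0) (z : ℤ) :
    rateUp c z + rateDown c z = 1 + (c z : ℝ≥0∞) := passSum_harmonic c z

/-- The probability that the tilted walk started at `x` first hits `y` at the `n`-th jump and not
after time `t`. -/
def hitTerm (c : ℤ → ℝ≥0) (y : ℤ) (n : ℕ) (x : ℤ) (t : ℝ) : ℝ≥0∞ :=
  tiltedLaw c x (hitSet x y n ∩ {ω | (holdSum n ω : ℝ) ≤ t})

theorem measurableSet_holdSum_le (n : ℕ) (t : ℝ) :
    MeasurableSet {ω : Sample | (holdSum n ω : ℝ) ≤ t} :=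
  measurableSet_le (measurable_holdSum n).coe_nnreal_real measurable_const

theorem hitTerm_mono (c : ℤ → ℝ≥0) (y : ℤ) (n : ℕ) (x : ℤ) : Monotone (hitTerm c y n x) :=
  fun _ _ h => measure_mono (Set.inter_subset_inter_right _ fun _ hω => le_trans hω h)

theorem measurable_hitTerm (c : ℤ → ℝ≥0) (y : ℤ) (n : ℕ) (x : ℤ) : Measurable (hitTerm c y n x) :=
  (hitTerm_mono c y n x).measurable

theorem hitTerm_zero (c : ℤ → ℝ≥0) (x y : ℤ) (t : ℝ) :
    hitTerm c y 0 x t = if x = y ∧ 0 ≤ t then 1 else 0 := by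
  have : hitSet x y 0 ∩ {ω | (holdSum 0 ω : ℝ) ≤ t} = {_ω | x = y ∧ 0 ≤ t} := by
    ext ω
    simp [mem_hitSet_zero, holdSum_zero]
  rw [hitTerm, this]
  split_ifs with h <;> simp [h]

theorem hitTerm_self_succ (c : ℤ → ℝ≥0) (y : ℤ) (n : ℕ) (t : ℝ) : hitTerm c y (n + 1) y t = 0 := by
  have : hitSet y y (n + 1) = ∅ := Set.eq_empty_of_forall_notMem fun _ => notMem_hitSet_self_succ
  rw [hitTerm, this, Set.empty_inter, measure_empty]

/-- Decomposition at the first jump. The kernel is not normalized: the weights are jump rates, not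
jump probabilities. Time ranges over all reals, so holding times `s > t` contribute zero
automatically. -/
theorem hitTerm_succ (c : ℤ → ℝ≥0) {x y : ℤ} (hxy : x ≠ y) (n : ℕ) (t : ℝ) :
    hitTerm c y (n + 1) x t = ∫⁻ s, expDensity (1 + c x) s *
      (rateUp c x * hitTerm c y n (x + 1) (-s + t) +
        rateDown c x * hitTerm c y n (x - 1) (-s + t)) := by
  have hms : ∀ x n t, MeasurableSet (hitSet x y n ∩ {ω | (holdSum n ω : ℝ) ≤ t}) := fun x n t =>
    (measurableSet_hitSet x y n).inter (measurableSet_holdSum_le n t)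
  have h0 := lintegral_tiltedLaw c x (measurable_one.indicator (hms x (n + 1) t))
  rw [lintegral_indicator_one (hms x (n + 1) t)] at h0
  have h1 : ∀ (e : ℤ) (τ : ℝ≥0), ∫⁻ ω, (hitSet x y (n + 1) ∩
      {ω | (holdSum (n + 1) ω : ℝ) ≤ t}).indicator (1 : Sample → ℝ≥0∞) (seqCons (e, τ) ω)
        ∂tiltedLaw c (x + e) = hitTerm c y n (x + e) (-τ + t) := by
    intro e τ
    rw [hitTerm, ← lintegral_indicator_one (hms (x + e) n (-τ + t))]
    refine lintegral_congr fun ω => ?_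
    have : seqCons (e, τ) ω ∈ hitSet x y (n + 1) ∩ {ω | (holdSum (n + 1) ω : ℝ) ≤ t} ↔
        ω ∈ hitSet (x + e) y n ∩ {ω | (holdSum n ω : ℝ) ≤ -τ + t} := by
      simp only [Set.mem_inter_iff, seqCons_mem_hitSet hxy, Set.mem_ofPred_eq, holdSum_seqCons,
        NNReal.coe_add]
      refine and_congr_right fun _ => ?_
      constructor <;> intro h <;> linarith
    classical
    simp only [Set.indicator_apply, this, Pi.one_apply]
  have h2 := h1 1
  have h3 := h1 (-1)
  simp_rw [← sub_eq_add_neg] at h3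
  simp_rw [h2, h3] at h0
  have hsh : ∀ z, Measurable fun s : ℝ => hitTerm c y n z (-s + t) := fun z =>
    (measurable_hitTerm c y n z).comp (by fun_prop)
  have hm1 := hsh (x + 1)
  have hm2 := hsh (x - 1)
  have h4 := lintegral_holdLaw (f := fun s => ENNReal.ofReal (Real.exp (-(c x * s))) *
    (rateUp c x * hitTerm c y n (x + 1) (-s + t) +
        rateDown c x * hitTerm c y n (x - 1) (-s + t))) (by fun_prop)
  rw [hitTerm]
  refine h0.trans (h4.trans (lintegral_congr fun s => ?_))
  rw [← mul_assoc, expDensity_mul_exp]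

/-- The probability that the tilted walk started at `x` hits `y` not after time `t`. -/
def hitProb (c : ℤ → ℝ≥0) (y x : ℤ) (t : ℝ) : ℝ≥0∞ := ∑' n, hitTerm c y n x t

theorem hitProb_mono (c : ℤ → ℝ≥0) (y x : ℤ) : Monotone (hitProb c y x) :=
  fun _ _ h => ENNReal.tsum_le_tsum fun n => hitTerm_mono c y n x h

theorem measurable_hitProb (c : ℤ → ℝ≥0) (y x : ℤ) : Measurable (hitProb c y x) :=
  (hitProb_mono c y x).measurable

theorem hitProb_eq_measure (c : ℤ → ℝ≥0) (y x : ℤ) (t : ℝ) :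
    hitProb c y x t = tiltedLaw c x (⋃ n, hitSet x y n ∩ {ω | (holdSum n ω : ℝ) ≤ t}) := by
  rw [measure_iUnion]
  · rfl
  · exact fun m n hmn => ((pairwise_disjoint_hitSet x y hmn).mono Set.inter_subset_left
      Set.inter_subset_left)
  · exact fun n => (measurableSet_hitSet x y n).inter (measurableSet_holdSum_le n t)

theorem hitProb_le_one (c : ℤ → ℝ≥0) (y x : ℤ) (t : ℝ) : hitProb c y x t ≤ 1 := by
  rw [hitProb_eq_measure]
  exact prob_le_one

theorem hitProb_self (c : ℤ → ℝ≥0) (y : ℤ) (t : ℝ) : hitProb c y y t = if 0 ≤ t then 1 else 0 := by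
  rw [hitProb, tsum_eq_zero_add' ENNReal.summable]
  simp [hitTerm_zero, hitTerm_self_succ]

theorem sum_hitTerm_le (c : ℤ → ℝ≥0) (y x : ℤ) (t : ℝ) (n : ℕ) :
    ∑ i ∈ Finset.range n, hitTerm c y i x t ≤ hitProb c y x t :=
  ENNReal.sum_le_tsum _

theorem hitProb_le_of_sum_le {c : ℤ → ℝ≥0} {y x : ℤ} {t : ℝ} {K : ℝ≥0∞}
    (h : ∀ n, ∑ i ∈ Finset.range n, hitTerm c y i x t ≤ K) : hitProb c y x t ≤ K := by
  rw [hitProb, ENNReal.tsum_eq_iSup_nat]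
  exact iSup_le h

theorem measurable_hitTerm_step (c : ℤ → ℝ≥0) (y x : ℤ) (t : ℝ) (n : ℕ) :
    Measurable fun s => expDensity (1 + c x) s *
      (rateUp c x * hitTerm c y n (x + 1) (-s + t) +
        rateDown c x * hitTerm c y n (x - 1) (-s + t)) := by
  have hsh : ∀ z, Measurable fun s : ℝ => hitTerm c y n z (-s + t) := fun z =>
    (measurable_hitTerm c y n z).comp (by fun_prop)
  have hm1 := hsh (x + 1)
  have hm2 := hsh (x - 1)
  have := measurable_expDensity (1 + c x)
  fun_prop

theorem sum_hitTerm_succ (c : ℤ → ℝ≥0) {x y : ℤ} (hxy : x ≠ y) (n : ℕ) (t : ℝ) :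
    ∑ i ∈ Finset.range (n + 1), hitTerm c y i x t = ∫⁻ s, expDensity (1 + c x) s *
      (rateUp c x * ∑ i ∈ Finset.range n, hitTerm c y i (x + 1) (-s + t) +
        rateDown c x * ∑ i ∈ Finset.range n, hitTerm c y i (x - 1) (-s + t)) := by
  rw [Finset.sum_range_succ', hitTerm_zero, if_neg (fun h => hxy h.1), add_zero]
  simp_rw [hitTerm_succ c hxy]
  rw [← lintegral_finsetSum _ fun n _ => measurable_hitTerm_step c y x t n]
  simp_rw [← Finset.mul_sum, Finset.sum_add_distrib, ← Finset.mul_sum]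

theorem hitProb_eq_lconvolution (c : ℤ → ℝ≥0) {x y : ℤ} (hxy : x ≠ y) :
    hitProb c y x = lconvolution (expDensity (1 + c x))
      (fun s => rateUp c x * hitProb c y (x + 1) s + rateDown c x * hitProb c y (x - 1) s)
      volume := by
  funext t
  rw [hitProb, tsum_eq_zero_add' ENNReal.summable, hitTerm_zero, if_neg (fun h => hxy h.1),
    zero_add, lconvolution_def]
  simp_rw [hitTerm_succ c hxy]
  rw [← lintegral_tsum fun n => (measurable_hitTerm_step c y x t n).aemeasurable]
  simp_rw [ENNReal.tsum_mul_left, ENNReal.tsum_add, ENNReal.tsum_mul_left, hitProb]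

/-- The walk started at `x` must reach `z` first and then has less time left. Analytically, the
constant `hitProb c y z t` dominates every iterate started at or below `z`, since the kernel times
the total rate has mass one. -/
theorem hitProb_mono_start (c : ℤ → ℝ≥0) {x z y : ℤ} (hxz : x ≤ z) (hzy : z ≤ y) (t : ℝ) :
    hitProb c y x t ≤ hitProb c y z t := by
  refine hitProb_le_of_sum_le fun n => ?_
  induction n generalizing x t with
  | zero => simp
  | succ n ih =>
    rcases eq_or_lt_of_le hxz with rfl | hlt
    · exact sum_hitTerm_le _ _ _ _ _
    rw [sum_hitTerm_succ c (by omega)]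
    calc _ ≤ ∫⁻ s, expDensity (1 + c x) s * ((1 + (c x : ℝ≥0∞)) * hitProb c y z t) := by
          refine lintegral_mono fun s => ?_
          rcases lt_or_ge s 0 with hs | hs
          · simp [expDensity_of_neg hs]
          · have hmono := hitProb_mono c y z (show -s + t ≤ t by linarith)
            rw [← rateUp_add_rateDown, add_mul]
            gcongr
            · exact (ih (by omega) _).trans hmono
            · exact (ih (by omega) _).trans hmono
      _ = hitProb c y z t := by
          rw [lintegral_mul_const _ (measurable_expDensity _), lintegral_expDensity (by positivity),
            ENNReal.ofReal_add zero_le_one (NNReal.coe_nonneg _), ENNReal.ofReal_one,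
            ENNReal.ofReal_coe_nnreal, ← mul_assoc, ENNReal.inv_mul_cancel (by simp) (by simp),
            one_mul]

/-- The tilted walk hits `y` earlier if the tilt is stronger. -/
theorem hitProb_le_hitProb {c c' : ℤ → ℝ≥0} (h : ∀ z, c z ≤ c' z) {x y : ℤ} (hxy : x ≤ y) (t : ℝ) :
    hitProb c y x t ≤ hitProb c' y x t := by
  refine hitProb_le_of_sum_le fun n => ?_
  induction n generalizing x t with
  | zero => simp
  | succ n ih =>
    rcases eq_or_lt_of_le hxy with rfl | hlt
    · refine (sum_hitTerm_le _ _ _ _ _).trans ?_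
      rw [hitProb_self, hitProb_self]
    obtain ⟨d, hd⟩ := exists_add_of_le (h x)
    have hup : rateUp c x ≤ rateUp c' x := by
      unfold rateUp
      gcongr
      exact passSum_anti h (by omega)
    have hdown : rateDown c' x ≤ rateDown c x := by
      unfold rateDown
      gcongr
      exact passSum_anti h (by omega)
    obtain ⟨a, ha⟩ := exists_add_of_le hup
    obtain ⟨b, hb⟩ := exists_add_of_le hdown
    -- Comparing the total rates `1 + c x` and `1 + c' x`: the surplus `a` of up jumps consists of
    -- `b`, taken from the down jumps, and `d`, the extra total rate.
    have hab : a = b + d := by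
      have h1 := rateUp_add_rateDown c x
      have h2 := rateUp_add_rateDown c' x
      rw [hb] at h1
      rw [ha, hd, ENNReal.coe_add, ← add_assoc, ← h1] at h2
      have hne : rateUp c x + rateDown c' x ≠ ⊤ := by
        refine ne_top_of_le_ne_top (b := 1 + (c x : ℝ≥0∞)) (by simp) ?_
        rw [← h1, ← add_assoc]
        exact le_self_add
      refine (ENNReal.add_right_inj hne).1 ?_
      calc _ = rateUp c x + a + rateDown c' x := by ring
        _ = _ := by rw [h2]; ring
    have hm := measurable_hitProb c' y
    have hm1 := hm (x + 1)
    have hm2 := hm (x - 1)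
    have hcomp := lconvolution_expDensity_le (r := 1 + c x) (d := d)
      (q := fun s => rateUp c x * hitProb c' y (x + 1) s + rateDown c x * hitProb c' y (x - 1) s)
      (q' := fun s => rateUp c' x * hitProb c' y (x + 1) s + rateDown c' x * hitProb c' y (x - 1) s)
      (by positivity) d.coe_nonneg (by fun_prop) (by fun_prop)
      (v := hitProb c' y x)
      (by
        have := hitProb_eq_lconvolution c' hlt.ne
        rwa [hd, NNReal.coe_add, ← add_assoc] at this)
      (hitProb_le_one c' y x)
      -- The rate `b` moves from `x - 1` to `x + 1` and the rate `d` from staying at `x` to `x + 1`.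
      -- Both replacements increase the hitting probability.
      (fun s => by
        have hv1 := hitProb_mono_start c' (show x ≤ x + 1 by omega) (show x + 1 ≤ y by omega) s
        have hv2 := hitProb_mono_start c' (show x - 1 ≤ x + 1 by omega) (show x + 1 ≤ y by omega) s
        rw [ha, hb, hab, ENNReal.ofReal_coe_nnreal]
        calc _ = rateUp c x * hitProb c' y (x + 1) s + rateDown c' x * hitProb c' y (x - 1) s +
              (b * hitProb c' y (x - 1) s + d * hitProb c' y x s) := by ring
          _ ≤ rateUp c x * hitProb c' y (x + 1) s + rateDown c' x * hitProb c' y (x - 1) s +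
              (b * hitProb c' y (x + 1) s + d * hitProb c' y (x + 1) s) := by gcongr
          _ = _ := by ring) t
    -- The partial sums for `c` are iterates of its renewal operator started from zero, so one more
    -- iteration stays below the supersolution.
    refine le_trans ?_ hcomp
    rw [sum_hitTerm_succ c hlt.ne, lconvolution_def]
    refine lintegral_mono fun s => ?_
    gcongr
    · exact ih (by omega) _
    · exact ih (by omega) _

theorem tiltedLaw_hit_le (c : ℤ → ℝ≥0) {x y : ℤ} (hxy : x ≤ y) (t : ℝ≥0) :
    tiltedLaw c x {ω | hit x y ω ≤ (t : WithTop ℝ≥0)} = hitProb c y x t := by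
  rw [hitProb_eq_measure]
  refine measure_congr ?_
  filter_upwards [ae_pos_tiltedLaw c x, ae_exists_mem_hitSet_tiltedLaw c hxy] with ω hpos hω
  obtain ⟨n, hn⟩ := hω
  refine propext ?_
  change hit x y ω ≤ (t : WithTop ℝ≥0) ↔ ω ∈ ⋃ n, hitSet x y n ∩ {ω | (holdSum n ω : ℝ) ≤ t}
  rw [hit_eq_holdSum hpos hn, WithTop.coe_le_coe]
  simp only [Set.mem_iUnion, Set.mem_inter_iff, Set.mem_ofPred_eq, NNReal.coe_le_coe]
  refine ⟨fun h => ⟨n, hn, h⟩, ?_⟩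
  rintro ⟨m, hm, h⟩
  have : m = n := by
    by_contra hmn
    exact Set.disjoint_left.1 (pairwise_disjoint_hitSet x y hmn) hm hn
  exact this ▸ h

/-- The event belongs to `stoppedSigma x y`, where all tilted laws agree, so no uniqueness on
`walkSigma x` is required. -/
theorem IsTiltedLaw.hit_le_eq_hitProb {x y : ℤ} (hxy : x ≤ y) {ζ : ℤ → ℝ} {η : ℝ} {c : ℤ → ℝ≥0}
    (hc : ∀ z, (c z : ℝ) = -(ζ z + η)) {Q : @Measure Sample (walkSigma x)}
    (hQ : IsTiltedLaw x ζ η Q) (t : ℝ≥0) :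
    Q {ω | hit x y ω ≤ (t : WithTop ℝ≥0)} = hitProb c y x t := by
  have hm := measurableSet_hit_le_stoppedSigma x y t
  rw [hQ.eq_stopped y hxy _ hm, ← tiltedLaw_apply hxy hc hm, tiltedLaw_hit_le c hxy]

end

end TiltedWalk

open TiltedWalk in
theorem corollary5p3 (D η : ℝ) (ζ : ℤ → ℝ) (hη : η ≤ 0)
    (hζ : ∀ z : ℤ, ζ z ∈ Set.Icc (-D) 0) (x y : ℤ) (hxy : x ≤ y) (t : ℝ≥0) :
    ((∃ Q : @Measure Sample (walkSigma x), IsTiltedLaw x (fun _ => 0) η Q) ∧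
      (∃ Q : @Measure Sample (walkSigma x), IsTiltedLaw x ζ η Q) ∧
      (∃ Q : @Measure Sample (walkSigma x), IsTiltedLaw x (fun _ => -D) η Q)) ∧
    ∀ Q₀ Qζ QD : @Measure Sample (walkSigma x),
      IsTiltedLaw x (fun _ => 0) η Q₀ →
      IsTiltedLaw x ζ η Qζ →
      IsTiltedLaw x (fun _ => -D) η QD →
      Q₀ {ω | hit x y ω ≤ (t : WithTop ℝ≥0)} ≤ Qζ {ω | hit x y ω ≤ (t : WithTop ℝ≥0)} ∧
      Qζ {ω | hit x y ω ≤ (t : WithTop ℝ≥0)} ≤ QD {ω | hit x y ω ≤ (t : WithTop ℝ≥0)} := by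
  have hc : ∀ ξ : ℤ → ℝ, (∀ z, ξ z ≤ 0) →
      ∀ z, ((-(ξ z + η)).toNNReal : ℝ) = -(ξ z + η) := fun ξ hξ z =>
    Real.coe_toNNReal _ (by linarith [hξ z])
  have h0 := hc (fun _ => 0) fun _ => le_rfl
  have h1 := hc ζ fun z => (hζ z).2
  -- That `-D ≤ 0` holds because the interval `[-D, 0]` contains `ζ z`.
  have h2 := hc (fun _ => -D) fun z => (hζ z).1.trans (hζ z).2
  refine ⟨⟨⟨_, isTiltedLaw_trim x h0⟩, ⟨_, isTiltedLaw_trim x h1⟩, ⟨_, isTiltedLaw_trim x h2⟩⟩,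
    fun Q₀ Qζ QD hQ₀ hQζ hQD => ?_⟩
  rw [hQ₀.hit_le_eq_hitProb hxy h0, hQζ.hit_le_eq_hitProb hxy h1, hQD.hit_le_eq_hitProb hxy h2]
  exact ⟨hitProb_le_hitProb (fun z => Real.toNNReal_le_toNNReal (by linarith [(hζ z).2])) hxy t,
    hitProb_le_hitProb (fun z => Real.toNNReal_le_toNNReal (by linarith [(hζ z).1])) hxy t⟩
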